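/- Let $M$ be an $n$-dimensional smooth manifold (field space) with a smooth pseudo-Riemannian metric $g$ of arbitrary signature and Levi-Civita connection $\nabla$. The Riemann tensor is $R^\rho{}_{\sigma\mu\nu}=\partial_\mu\Gamma^\rho_{\nu\sigma}-\partial_\nu\Gamma^\rho_{\mu\sigma}+\Gamma^\rho_{\mu\kappa}\Gamma^\kappa_{\nu\sigma}-\Gamma^\rho_{\nu\kappa}\Gamma^\kappa_{\mu\sigma}$, and $R_{\rho\sigma\mu\nu}=g_{\rho\kappa}R^\kappa{}_{\sigma\mu\nu}$. A smooth vector field $\xi$ is called homothetic if $\nabla_\mu\xi_\nu+\nabla_\nu\xi_\mu=\lambda g_{\mu\nu}$ for a constant $\lambda\in\mathbb R$ ($\lambda=0$, a Killing field, is allowed). Let $(\xi_{(i)})_{i}$ be a finite family of homothetic vector fields with constants $\lambda_{(i)}$, and put $V_{(ij)}=g(\xi_{(i)},\xi_{(j)})$. On the phase space $T^*M$, with the canonical Poisson bracket $\{q^\mu,p_\nu\}=\delta^\mu_\nu$, put $C_{(i)}=p_\mu\xi_{(i)}^\mu$ and $H=\tfrac12 g^{\mu\nu}p_\mu p_\nu$.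 1. Let $\gamma$ be an affinely parametrised smooth geodesic of $g$ (a free motion) defined on an open set of times, with velocity $p^\mu=\dot q^\mu$. Then $V_{(ij)}\circ\gamma$ is three times continuously differentiable and, in every smooth chart, $$\frac{d^3}{dt^3}V_{(ij)}=-2p^\mu p^\nu p^\rho\Big(2(\nabla_\rho\xi_{(j)}^\sigma)R_{\sigma\mu\kappa\nu}\xi_{(i)}^\kappa+2(\nabla_\rho\xi_{(i)}^\sigma)R_{\sigma\mu\kappa\nu}\xi_{(j)}^\kappa+\xi_{(i)}^\sigma\xi_{(j)}^\kappa\nabla_\rho R_{\sigma\mu\kappa\nu}\Big).$$ 2. If the Riemann tensor vanishes identically, then $\frac{d^3}{dt^3}V_{(ij)}=0$ along every such geodesic. 3. Suppose that the $\xi_{(i)}$ span the space of all homothetic vector fields of $g$. Then the real linear span of $H$, all the $C_{(i)}$ and all the $V_{(ij)}$ is closed under the Poisson bracket if and only if for all $i,j$ there are real constants $\alpha^k$ (depending on $i,j$) with $$\xi_{(i)}^\nu\nabla_\nu\xi_{(j)\mu}+\xi_{(j)}^\nu\nabla_\nu\xi_{(i)\mu}=\sum_k\alpha^k\xi_{(k)\mu}\quad\text{on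 } M.$$ The same equivalence holds if, instead, the span of the $\xi_{(i)}$ is only assumed to be closed under the Lie bracket of vector fields. -/

import Mathlib

open scoped Manifold ContDiff Bundle Topology

noncomputable section

namespace FieldSpace

/-- The coordinate space `ℝⁿ`. -/
abbrev Coord (n : ℕ) : Type := EuclideanSpace ℝ (Fin n)

/-! ### Tensor calculus in coordinates

The argument `G` is the matrix of components `g_{μν}` of a metric as a function of the
coordinates. -/

section Coordinates

variable {n : ℕ}

/-- The partial derivative `∂_μ f` at `y`. -/
def pd (μ : Fin n) (f : Coord n → ℝ) (y : Coord n) : ℝ :=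
  fderiv ℝ f y (EuclideanSpace.single μ 1)

/-- The Christoffel symbols `Γ^ρ_{μν}`. -/
def christoffel (G : Coord n → Matrix (Fin n) (Fin n) ℝ) (ρ μ ν : Fin n) (y : Coord n) : ℝ :=
  (1 / 2) * ∑ σ, (G y)⁻¹ ρ σ *
    (pd μ (fun z => G z σ ν) y + pd ν (fun z => G z σ μ) y - pd σ (fun z => G z μ ν) y)

/-- `∇_ρ X^σ` for the components `X^σ` of a vector field. -/
def nablaUp (G : Coord n → Matrix (Fin n) (Fin n) ℝ) (X : Fin n → Coord n → ℝ)
    (ρ σ : Fin n) (y : Coord n) : ℝ :=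
  pd ρ (X σ) y + ∑ κ, christoffel G σ ρ κ y * X κ y

/-- The components `X_μ = g_{μν} X^ν`. -/
def lower (G : Coord n → Matrix (Fin n) (Fin n) ℝ) (X : Fin n → Coord n → ℝ)
    (μ : Fin n) (y : Coord n) : ℝ :=
  ∑ ν, G y μ ν * X ν y

/-- `∇_ν w_μ` for the components `w_μ` of a one-form. -/
def nablaDown (G : Coord n → Matrix (Fin n) (Fin n) ℝ) (w : Fin n → Coord n → ℝ)
    (ν μ : Fin n) (y : Coord n) : ℝ :=
  pd ν (w μ) y - ∑ κ, christoffel G κ ν μ y * w κ y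

/-- The Riemann tensor `R^ρ_{σμν} = ∂_μ Γ^ρ_{νσ} - ∂_ν Γ^ρ_{μσ} + Γ^ρ_{μκ} Γ^κ_{νσ}
- Γ^ρ_{νκ} Γ^κ_{μσ}`, so that `[∇_μ, ∇_ν] X^ρ = R^ρ_{σμν} X^σ`. -/
def riemannUp (G : Coord n → Matrix (Fin n) (Fin n) ℝ) (ρ σ μ ν : Fin n) (y : Coord n) : ℝ :=
  pd μ (christoffel G ρ ν σ) y - pd ν (christoffel G ρ μ σ) y
    + ∑ κ, (christoffel G ρ μ κ y * christoffel G κ ν σ y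
      - christoffel G ρ ν κ y * christoffel G κ μ σ y)

/-- The Riemann tensor with all indices down, `R_{ρσμν} = g_{ρκ} R^κ_{σμν}`. -/
def riemann (G : Coord n → Matrix (Fin n) (Fin n) ℝ) (ρ σ μ ν : Fin n) (y : Coord n) : ℝ :=
  ∑ κ, G y ρ κ * riemannUp G κ σ μ ν y

/-- The covariant derivative `∇_ρ R_{σμκν}` of the Riemann tensor. -/
def nablaRiemann (G : Coord n → Matrix (Fin n) (Fin n) ℝ) (ρ σ μ κ ν : Fin n)
    (y : Coord n) : ℝ :=
  pd ρ (riemann G σ μ κ ν) y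
    - ∑ τ, (christoffel G τ ρ σ y * riemann G τ μ κ ν y
      + christoffel G τ ρ μ y * riemann G σ τ κ ν y
      + christoffel G τ ρ κ y * riemann G σ μ τ ν y
      + christoffel G τ ρ ν y * riemann G σ μ κ τ y)

/-- `X^ν ∇_ν Y_μ + Y^ν ∇_ν X_μ`. -/
def symProduct (G : Coord n → Matrix (Fin n) (Fin n) ℝ) (X Y : Fin n → Coord n → ℝ)
    (μ : Fin n) (y : Coord n) : ℝ :=
  ∑ ν, (X ν y * nablaDown G (lower G Y) ν μ y + Y ν y * nablaDown G (lower G X) ν μ y)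

/-- `-2 p^μ p^ν p^ρ (2 (∇_ρ Y^σ) R_{σμκν} X^κ + 2 (∇_ρ X^σ) R_{σμκν} Y^κ
+ X^σ Y^κ ∇_ρ R_{σμκν})`. -/
def thirdDerivExpr (G : Coord n → Matrix (Fin n) (Fin n) ℝ) (X Y : Fin n → Coord n → ℝ)
    (p : Fin n → ℝ) (y : Coord n) : ℝ :=
  -2 * ∑ μ, ∑ ν, ∑ ρ, ∑ σ, ∑ κ, p μ * p ν * p ρ *
    (2 * nablaUp G Y ρ σ y * riemann G σ μ κ ν y * X κ y
      + 2 * nablaUp G X ρ σ y * riemann G σ μ κ ν y * Y κ y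
      + X σ y * Y κ y * nablaRiemann G ρ σ μ κ ν y)

end Coordinates

/-! ### Field space: a smooth manifold with a pseudo-Riemannian metric -/

variable {n : ℕ} {M : Type*} [TopologicalSpace M] [ChartedSpace (Coord n) M]

variable (n M) in
/-- A smooth symmetric nondegenerate metric of arbitrary signature. -/
structure PseudoMetric [IsManifold (𝓡 n) ∞ M] where
  /-- The bilinear form on each tangent space. -/
  form (x : M) : TangentSpace (𝓡 n) x →L[ℝ] TangentSpace (𝓡 n) x →L[ℝ] ℝ
  symm (x : M) (v w : TangentSpace (𝓡 n) x) : form x v w = form x w v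
  nondegenerate (x : M) (v : TangentSpace (𝓡 n) x) (hv : ∀ w, form x v w = 0) : v = 0
  smooth : ContMDiff (𝓡 n) ((𝓡 n).prod 𝓘(ℝ, Coord n →L[ℝ] Coord n →L[ℝ] ℝ)) ∞
    (fun x => Bundle.TotalSpace.mk' (Coord n →L[ℝ] Coord n →L[ℝ] ℝ) x (form x))

variable (n M) in
/-- Smooth charts: all charts of the maximal smooth atlas. -/
def charts : Set (OpenPartialHomeomorph M (Coord n)) :=
  IsManifold.maximalAtlas (𝓡 n) ∞ M

/-- The coordinate vector `∂_μ` of the chart `φ` at the point with coordinates `y`. -/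
def coordVec (φ : OpenPartialHomeomorph M (Coord n)) (μ : Fin n) (y : Coord n) :
    TangentSpace (𝓡 n) (φ.symm y) :=
  mfderiv (𝓡 n) (𝓡 n) φ.symm y (EuclideanSpace.single μ (1 : ℝ) : Coord n)

/-- The coordinate one-form `dq^μ` of the chart `φ` at `x`. -/
def coordForm (φ : OpenPartialHomeomorph M (Coord n)) (μ : Fin n) (x : M) :
    TangentSpace (𝓡 n) x →L[ℝ] ℝ :=
  (EuclideanSpace.proj μ : Coord n →L[ℝ] ℝ).comp (mfderiv (𝓡 n) (𝓡 n) φ x)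

/-- The components `ξ^μ` of a vector field in the chart `φ`. -/
def vecComp (φ : OpenPartialHomeomorph M (Coord n)) (ξ : ∀ x : M, TangentSpace (𝓡 n) x)
    (μ : Fin n) (y : Coord n) : ℝ :=
  coordForm φ μ (φ.symm y) (ξ (φ.symm y))

section Metric

variable [IsManifold (𝓡 n) ∞ M] (g : PseudoMetric n M)

/-- The components `g_{μν}` of the metric in the chart `φ`. -/
def metricComp (φ : OpenPartialHomeomorph M (Coord n)) (y : Coord n) :
    Matrix (Fin n) (Fin n) ℝ :=
  Matrix.of fun μ ν => g.form (φ.symm y) (coordVec φ μ y) (coordVec φ ν y)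

/-- `ξ` is a homothetic vector field with constant `c`: `∇_μ ξ_ν + ∇_ν ξ_μ = c g_{μν}`.
The value `c = 0` (a Killing field) is allowed. -/
structure IsHomothetic (ξ : ∀ x : M, TangentSpace (𝓡 n) x) (c : ℝ) : Prop where
  smooth : ContMDiff (𝓡 n) (𝓡 n).tangent ∞ (fun x => (⟨x, ξ x⟩ : TangentBundle (𝓡 n) M))
  eqn : ∀ φ ∈ charts n M, ∀ y ∈ φ.target, ∀ μ ν,
    nablaDown (metricComp g φ) (lower (metricComp g φ) (vecComp φ ξ)) μ ν y
      + nablaDown (metricComp g φ) (lower (metricComp g φ) (vecComp φ ξ)) ν μ y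
      = c * metricComp g φ y μ ν

/-- The Riemann tensor vanishes identically. -/
def IsFlat : Prop :=
  ∀ φ ∈ charts n M, ∀ y ∈ φ.target, ∀ ρ σ μ ν, riemann (metricComp g φ) ρ σ μ ν y = 0

/-- The velocity components `dq^μ/dt` of a curve in the chart `φ`. -/
def velocity (φ : OpenPartialHomeomorph M (Coord n)) (γ : ℝ → M) (t : ℝ) (μ : Fin n) : ℝ :=
  deriv (fun s => φ (γ s) μ) t

/-- `γ` is, on the set `J` of times, a smooth affinely parametrised solution of the geodesic
equation. -/
structure IsGeodesicOn (γ : ℝ → M) (J : Set ℝ) : Prop where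
  smooth : ContMDiffOn 𝓘(ℝ, ℝ) (𝓡 n) ∞ γ J
  eqn : ∀ φ ∈ charts n M, ∀ t ∈ J, γ t ∈ φ.source → ∀ μ,
    iteratedDeriv 2 (fun s => φ (γ s) μ) t
      + ∑ ρ, ∑ σ, christoffel (metricComp g φ) μ ρ σ (φ (γ t))
          * velocity φ γ t ρ * velocity φ γ t σ = 0

/-- The function `V = g(ξ, η)` on field space. -/
def scalarProduct (ξ η : ∀ x : M, TangentSpace (𝓡 n) x) (x : M) : ℝ :=
  g.form x (ξ x) (η x)

/-! ### Phase space: the cotangent bundle -/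

variable (n M) in
/-- Functions of a point `x` of field space and a momentum `p` in the cotangent space at `x`. -/
abbrev PhaseFun : Type _ := ∀ x : M, (TangentSpace (𝓡 n) x →L[ℝ] ℝ) → ℝ

theorem PseudoMetric.exists_sharp (x : M) (p : TangentSpace (𝓡 n) x →L[ℝ] ℝ) :
    ∃ v : TangentSpace (𝓡 n) x, g.form x v = p := by
  let L : Coord n →ₗ[ℝ] (Coord n →L[ℝ] ℝ) := (g.form x).toLinearMap
  have hinj : Function.Injective L := by
    rw [injective_iff_map_eq_zero]
    intro v hv
    exact g.nondegenerate x v fun w => congrArg (fun f : Coord n →L[ℝ] ℝ => f w) hv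
  have hdim : Module.finrank ℝ (Coord n) = Module.finrank ℝ (Coord n →L[ℝ] ℝ) := by
    rw [← (LinearMap.toContinuousLinearMap :
      (Coord n →ₗ[ℝ] ℝ) ≃ₗ[ℝ] (Coord n →L[ℝ] ℝ)).finrank_eq]
    exact (Subspace.dual_finrank_eq (K := ℝ) (V := Coord n)).symm
  exact (LinearMap.injective_iff_surjective_of_finrank_eq_finrank hdim).1 hinj p

/-- The vector `p^μ = g^{μν} p_ν` obtained from a momentum by raising the index. -/
def PseudoMetric.sharp (x : M) (p : TangentSpace (𝓡 n) x →L[ℝ] ℝ) : TangentSpace (𝓡 n) x :=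
  (g.exists_sharp x p).choose

/-- The free Hamiltonian `H = p^μ p_μ / 2`. -/
def hamiltonian : PhaseFun n M := fun x p => (1 / 2) * p (g.sharp x p)

end Metric

/-- The phase space function `C = p_μ ξ^μ`. -/
def linearCharge (ξ : ∀ x : M, TangentSpace (𝓡 n) x) : PhaseFun n M := fun x p => p (ξ x)

/-- A function on field space as a function on phase space. -/
def ofBase (f : M → ℝ) : PhaseFun n M := fun x _ => f x

/-- A phase space function in the canonical coordinates `(q^μ, p_μ)` induced by the chart `φ`. -/
def inCoords (φ : OpenPartialHomeomorph M (Coord n)) (F : PhaseFun n M) (y a : Coord n) : ℝ :=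
  F (φ.symm y) (∑ μ, a μ • coordForm φ μ (φ.symm y))

/-- The canonical Poisson bracket `∂F/∂q^μ ∂K/∂p_μ - ∂F/∂p_μ ∂K/∂q^μ`, at a point `x` computed in
the canonical coordinates of the preferred chart at `x`. -/
def poisson (F K : PhaseFun n M) : PhaseFun n M := fun x p =>
  let φ := chartAt (Coord n) x
  let y : Coord n := φ x
  let a : Coord n := WithLp.toLp 2 fun μ => p (mfderiv (𝓡 n) (𝓡 n) φ.symm (φ x)
    (EuclideanSpace.single μ (1 : ℝ) : Coord n))
  ∑ μ, (pd μ (fun z => inCoords φ F z a) y * pd μ (fun b => inCoords φ K y b) a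
    - pd μ (fun b => inCoords φ F y b) a * pd μ (fun z => inCoords φ K z a) y)

section Algebra

variable [IsManifold (𝓡 n) ∞ M] (g : PseudoMetric n M)

/-- The real linear span of `H`, of all the `C_(i)` and of all the `V_(ij)`. -/
def chargeSpan {ι : Type*} (ξ : ι → ∀ x : M, TangentSpace (𝓡 n) x) :
    Submodule ℝ (PhaseFun n M) :=
  Submodule.span ℝ ({hamiltonian g} ∪ (Set.range fun i => linearCharge (ξ i))
    ∪ (Set.range fun ij : ι × ι => ofBase (scalarProduct g (ξ ij.1) (ξ ij.2))))

/-- `H`, the `C_(i)` and the `V_(ij)` close an algebra: their span is stable under the Poisson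
bracket. -/
def ClosesAlgebra {ι : Type*} (ξ : ι → ∀ x : M, TangentSpace (𝓡 n) x) : Prop :=
  ∀ F ∈ chargeSpan g ξ, ∀ K ∈ chargeSpan g ξ, poisson F K ∈ chargeSpan g ξ

/-- For all `i`, `j` there are constants `α^k` with
`ξ_(i)^ν ∇_ν ξ_(j)μ + ξ_(j)^ν ∇_ν ξ_(i)μ = ∑_k α^k ξ_(k)μ`. -/
def SymProductCondition {ι : Type*} [Fintype ι] (ξ : ι → ∀ x : M, TangentSpace (𝓡 n) x) :
    Prop :=
  ∀ i j, ∃ α : ι → ℝ, ∀ φ ∈ charts n M, ∀ y ∈ φ.target, ∀ μ,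
    symProduct (metricComp g φ) (vecComp φ (ξ i)) (vecComp φ (ξ j)) μ y
      = ∑ k, α k * lower (metricComp g φ) (vecComp φ (ξ k)) μ y

end Algebra

end FieldSpace

end

noncomputable section

set_option maxSynthPendingDepth 3

namespace FieldSpace

/-! ### Levi-Civita connections on open subsets of a normed space -/

section Local

variable {E : Type*} [NormedAddCommGroup E] [NormedSpace ℝ E]

section Product

variable {F₁ F₂ F₃ : Type*} [NormedAddCommGroup F₁] [NormedSpace ℝ F₁]
  [NormedAddCommGroup F₂] [NormedSpace ℝ F₂] [NormedAddCommGroup F₃] [NormedSpace ℝ F₃]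

/-! Everything is read in a chart, where the metric is a smooth field of bilinear forms and the
Levi-Civita connection a smooth field of bilinear maps pinned down by Koszul's formula. The
identities are proved index-free there and translated into components by multilinearity.

Third derivative. Rescaling a metric by a constant does not change its connection, so a homothetic
field preserves the connection (`IsLeviCivita.lie_conn`). Along a geodesic with velocity p this says
that ξ is a Jacobi field: ξ'' = -R(ξ, p)p, primes being covariant derivatives along the curve
(`IsLeviCivita.hasDerivAt_covDeriv`). The Leibniz rule and the pair symmetry of R give V'' = 2 g(ξ',
η') - 2 R(ξ, p, η, p), and one more derivative gives the formula
(`IsLeviCivita.iteratedDeriv_three_metric`). Each of its terms contains R or ∇R, hence the flat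
case.

Closure. The brackets of the generators are {C_ξ, C_η} = -C_[ξ,η], {C_ξ, H} = cH, {C_ξ, V} = -ξ(V),
{V, V'} = 0 and {V, H} = dV(p♯), with p♯ the raised momentum. Expanding ξ(V) with L_ξ g = c g shows
that all but the last stay in the span once the family is closed under the Lie bracket. This is
automatic if the family spans all homothetic fields, since the bracket of two of them is Killing. So
only {V, H} matters. It is linear in the momenta, and comparing parts odd in p shows that it lies in
the span exactly when dV is a constant combination of the one-forms g(ξ_k, ·). The homothetic
equation also gives g(w, ∇_ξ η + ∇_η ξ) = c g(w, η) + c' g(w, ξ) - dV(w), so this is the stated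
condition on the symmetric product (`symProductCondition_iff_gradient`). -/

theorem fderiv_apply_one {A : E → F₁ →L[ℝ] F₂} {X : E → F₁} {y : E}
    (hA : DifferentiableAt ℝ A y) (hX : DifferentiableAt ℝ X y) (a : E) :
    fderiv ℝ (fun z => A z (X z)) y a = fderiv ℝ A y a (X y) + A y (fderiv ℝ X y a) := by
  rw [fderiv_clm_apply hA hX]
  simp [add_comm]

theorem fderiv_apply_two {A : E → F₁ →L[ℝ] F₂ →L[ℝ] F₃} {X : E → F₁} {Y : E → F₂} {y : E}
    (hA : DifferentiableAt ℝ A y) (hX : DifferentiableAt ℝ X y) (hY : DifferentiableAt ℝ Y y)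
    (a : E) :
    fderiv ℝ (fun z => A z (X z) (Y z)) y a
      = fderiv ℝ A y a (X y) (Y y) + A y (fderiv ℝ X y a) (Y y) + A y (X y) (fderiv ℝ Y y a) := by
  rw [fderiv_apply_one (A := fun z => A z (X z)) (hA.clm_apply hX) hY, fderiv_apply_one hA hX]
  simp

theorem fderiv_apply_const {A : E → F₁ →L[ℝ] F₂ →L[ℝ] F₃} {y : E}
    (hA : DifferentiableAt ℝ A y) (v : F₁) (w : F₂) (a : E) :
    fderiv ℝ (fun z => A z v w) y a = fderiv ℝ A y a v w := by
  rw [fderiv_apply_two (X := fun _ => v) (Y := fun _ => w) hA (by fun_prop) (by fun_prop)]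
  simp

theorem fderiv_apply_fderiv_const {A : E → F₁ →L[ℝ] F₂ →L[ℝ] F₃} {y : E}
    (hA : DifferentiableAt ℝ (fderiv ℝ A) y) (b : E) (v : F₁) (w : F₂) (a : E) :
    fderiv ℝ (fun z => fderiv ℝ A z b v w) y a = fderiv ℝ (fderiv ℝ A) y a b v w := by
  rw [fderiv_apply_const (A := fun z => fderiv ℝ A z b) (hA.clm_apply (by fun_prop)),
    fderiv_apply_one hA (by fun_prop)]
  simp

end Product

theorem ContDiffOn.differentiableAt_of_isOpen {F : Type*} [NormedAddCommGroup F] [NormedSpace ℝ F]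
    {f : E → F} {U : Set E} (hf : ContDiffOn ℝ ∞ f U) (hU : IsOpen U) {y : E} (hy : y ∈ U) :
    DifferentiableAt ℝ f y :=
  (hf.contDiffAt (hU.mem_nhds hy)).differentiableAt (by simp)

theorem ContDiffOn.fderiv_of_smooth {F : Type*} [NormedAddCommGroup F] [NormedSpace ℝ F]
    {f : E → F} {U : Set E} (hf : ContDiffOn ℝ ∞ f U) (hU : IsOpen U) :
    ContDiffOn ℝ ∞ (fderiv ℝ f) U :=
  hf.fderiv_of_isOpen hU (by simp)

theorem ContDiffOn.fderiv_fderiv_comm {F : Type*} [NormedAddCommGroup F] [NormedSpace ℝ F]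
    {f : E → F} {U : Set E} (hf : ContDiffOn ℝ ∞ f U) (hU : IsOpen U) {y : E} (hy : y ∈ U)
    (a b : E) : fderiv ℝ (fderiv ℝ f) y a b = fderiv ℝ (fderiv ℝ f) y b a :=
  ((hf.contDiffAt (hU.mem_nhds hy)).isSymmSndFDerivAt
    (by rw [minSmoothness_of_isRCLikeNormedField]; exact ENat.LEInfty.out)) a b

/-- `Γ` is the Levi-Civita connection of the smooth metric `B` on the open set `U`. -/
structure IsLeviCivita (U : Set E) (B : E → E →L[ℝ] E →L[ℝ] ℝ)
    (Γ : E → E →L[ℝ] E →L[ℝ] E) : Prop where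
  isOpen : IsOpen U
  smooth_metric : ContDiffOn ℝ ∞ B U
  smooth_conn : ContDiffOn ℝ ∞ Γ U
  symm : ∀ y ∈ U, ∀ v w, B y v w = B y w v
  nondeg : ∀ y ∈ U, ∀ v, (∀ w, B y v w = 0) → v = 0
  koszul : ∀ y ∈ U, ∀ v w z, B y (Γ y v w) z =
    (1 / 2) * (fderiv ℝ B y v w z + fderiv ℝ B y w v z - fderiv ℝ B y z v w)

/-- The curvature `R(u, v) w` of a connection. -/
def curv (Γ : E → E →L[ℝ] E →L[ℝ] E) (y u v w : E) : E :=
  fderiv ℝ Γ y u v w - fderiv ℝ Γ y v u w + Γ y u (Γ y v w) - Γ y v (Γ y u w)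

/-- The curvature tensor with all indices down. -/
def curvDown (B : E → E →L[ℝ] E →L[ℝ] ℝ) (Γ : E → E →L[ℝ] E →L[ℝ] E) (y a b c d : E) : ℝ :=
  B y a (curv Γ y c d b)

/-- The covariant derivative `(∇_r R)(a, b, c, d)` of the curvature tensor. -/
def nablaCurv (B : E → E →L[ℝ] E →L[ℝ] ℝ) (Γ : E → E →L[ℝ] E →L[ℝ] E) (y r a b c d : E) : ℝ :=
  fderiv ℝ (fun z => curvDown B Γ z a b c d) y r
    - (curvDown B Γ y (Γ y r a) b c d + curvDown B Γ y a (Γ y r b) c d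
      + curvDown B Γ y a b (Γ y r c) d + curvDown B Γ y a b c (Γ y r d))

/-- `X` is, on `U`, a homothetic field of the metric `B`: `L_X B = c B`. -/
def IsHomotheticOn (U : Set E) (B : E → E →L[ℝ] E →L[ℝ] ℝ) (X : E → E) (c : ℝ) : Prop :=
  ∀ y ∈ U, ∀ v w, fderiv ℝ B y (X y) v w + B y (fderiv ℝ X y v) w + B y v (fderiv ℝ X y w)
    = c * B y v w

section

variable {U : Set E} {B : E → E →L[ℝ] E →L[ℝ] ℝ} {Γ : E → E →L[ℝ] E →L[ℝ] E} {X Y : E → E}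
  {c c' : ℝ} {y : E}

theorem fderiv_symm_of_symm {F : Type*} [NormedAddCommGroup F] [NormedSpace ℝ F]
    {B : E → E →L[ℝ] E →L[ℝ] F} (hU : IsOpen U) (hB : ContDiffOn ℝ ∞ B U)
    (hs : ∀ y ∈ U, ∀ v w, B y v w = B y w v) (hy : y ∈ U) (a v w : E) :
    fderiv ℝ B y a v w = fderiv ℝ B y a w v := by
  have hd := ContDiffOn.differentiableAt_of_isOpen hB hU hy
  rw [← fderiv_apply_const hd, ← fderiv_apply_const hd]
  have : (fun z => B z v w) =ᶠ[𝓝 y] fun z => B z w v := by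
    filter_upwards [hU.mem_nhds hy] with z hz using hs z hz v w
  rw [this.fderiv_eq]

theorem fderiv_fderiv_symm_of_symm (hU : IsOpen U) (hB : ContDiffOn ℝ ∞ B U)
    (hs : ∀ y ∈ U, ∀ v w, B y v w = B y w v) (hy : y ∈ U) (a b v w : E) :
    fderiv ℝ (fderiv ℝ B) y a b v w = fderiv ℝ (fderiv ℝ B) y a b w v := by
  have hd := ContDiffOn.differentiableAt_of_isOpen (ContDiffOn.fderiv_of_smooth hB hU) hU hy
  rw [← fderiv_apply_fderiv_const hd, ← fderiv_apply_fderiv_const hd]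
  have : (fun z => fderiv ℝ B z b v w) =ᶠ[𝓝 y] fun z => fderiv ℝ B z b w v := by
    filter_upwards [hU.mem_nhds hy] with z hz using fderiv_symm_of_symm hU hB hs hz b v w
  rw [this.fderiv_eq]

/-- The derivative of the equation `L_X B = c B`. -/
theorem IsHomotheticOn.fderiv_eqn (h : IsHomotheticOn U B X c) (hU : IsOpen U)
    (hB : ContDiffOn ℝ ∞ B U) (hX : ContDiffOn ℝ ∞ X U) (hy : y ∈ U) (a v w : E) :
    fderiv ℝ (fderiv ℝ B) y a (X y) v w + fderiv ℝ B y (fderiv ℝ X y a) v w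
      + (fderiv ℝ B y a (fderiv ℝ X y v) w + B y (fderiv ℝ (fderiv ℝ X) y a v) w)
      + (fderiv ℝ B y a v (fderiv ℝ X y w) + B y v (fderiv ℝ (fderiv ℝ X) y a w))
      = c * fderiv ℝ B y a v w := by
  have hB0 := ContDiffOn.differentiableAt_of_isOpen hB hU hy
  have hX0 := ContDiffOn.differentiableAt_of_isOpen hX hU hy
  have hB1 := ContDiffOn.differentiableAt_of_isOpen (ContDiffOn.fderiv_of_smooth hB hU) hU hy
  have hX1 := ContDiffOn.differentiableAt_of_isOpen (ContDiffOn.fderiv_of_smooth hX hU) hU hy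
  have hXc : ∀ u : E, DifferentiableAt ℝ (fun z => fderiv ℝ X z u) y := fun u =>
    hX1.clm_apply (by fun_prop)
  have hXf : ∀ u : E, fderiv ℝ (fun z => fderiv ℝ X z u) y a = fderiv ℝ (fderiv ℝ X) y a u := by
    intro u
    rw [fderiv_apply_one hX1 (by fun_prop)]
    simp
  have e1 : fderiv ℝ (fun z => fderiv ℝ B z (X z) v w) y a
      = fderiv ℝ (fderiv ℝ B) y a (X y) v w + fderiv ℝ B y (fderiv ℝ X y a) v w := by
    rw [fderiv_apply_const (A := fun z => fderiv ℝ B z (X z)) (hB1.clm_apply hX0),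
      fderiv_apply_one hB1 hX0]
    simp
  have e2 : fderiv ℝ (fun z => B z (fderiv ℝ X z v) w) y a
      = fderiv ℝ B y a (fderiv ℝ X y v) w + B y (fderiv ℝ (fderiv ℝ X) y a v) w := by
    rw [fderiv_apply_two (Y := fun _ => w) hB0 (hXc v) (by fun_prop), hXf]
    simp
  have e3 : fderiv ℝ (fun z => B z v (fderiv ℝ X z w)) y a
      = fderiv ℝ B y a v (fderiv ℝ X y w) + B y v (fderiv ℝ (fderiv ℝ X) y a w) := by
    rw [fderiv_apply_two (X := fun _ => v) hB0 (by fun_prop) (hXc w), hXf]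
    simp
  have d1 : DifferentiableAt ℝ (fun z => fderiv ℝ B z (X z) v w) y :=
    ((hB1.clm_apply hX0).clm_apply (by fun_prop)).clm_apply (by fun_prop)
  have d2 : DifferentiableAt ℝ (fun z => B z (fderiv ℝ X z v) w) y :=
    (hB0.clm_apply (hXc v)).clm_apply (by fun_prop)
  have d3 : DifferentiableAt ℝ (fun z => B z v (fderiv ℝ X z w)) y :=
    (hB0.clm_apply (by fun_prop)).clm_apply (hXc w)
  have d4 : DifferentiableAt ℝ (fun z => B z v w) y :=
    (hB0.clm_apply (by fun_prop)).clm_apply (by fun_prop)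
  have key : (fun z => fderiv ℝ B z (X z) v w + B z (fderiv ℝ X z v) w + B z v (fderiv ℝ X z w))
      =ᶠ[𝓝 y] fun z => c * B z v w := by
    filter_upwards [hU.mem_nhds hy] with z hz using h z hz v w
  have := congrArg (fun f : E →L[ℝ] ℝ => f a) key.fderiv_eq
  rw [fderiv_fun_add (d1.fun_add d2) d3, fderiv_fun_add d1 d2, fderiv_const_mul d4] at this
  simp only [add_apply, smul_apply, smul_eq_mul, e1, e2, e3, fderiv_apply_const hB0] at this
  exact this

/-- The Lie bracket of two homothetic fields is a Killing field. -/
theorem IsHomotheticOn.lieBracket (h : IsHomotheticOn U B X c) (h' : IsHomotheticOn U B Y c')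
    (hU : IsOpen U) (hB : ContDiffOn ℝ ∞ B U) (hX : ContDiffOn ℝ ∞ X U) (hY : ContDiffOn ℝ ∞ Y U) :
    IsHomotheticOn U B (VectorField.lieBracket ℝ X Y) 0 := by
  intro y hy v w
  have hX0 := ContDiffOn.differentiableAt_of_isOpen hX hU hy
  have hX1 := ContDiffOn.differentiableAt_of_isOpen (ContDiffOn.fderiv_of_smooth hX hU) hU hy
  have hY0 := ContDiffOn.differentiableAt_of_isOpen hY hU hy
  have hY1 := ContDiffOn.differentiableAt_of_isOpen (ContDiffOn.fderiv_of_smooth hY hU) hU hy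
  have hd : ∀ u, fderiv ℝ (VectorField.lieBracket ℝ X Y) y u
      = fderiv ℝ (fderiv ℝ Y) y u (X y) + fderiv ℝ Y y (fderiv ℝ X y u)
        - (fderiv ℝ (fderiv ℝ X) y u (Y y) + fderiv ℝ X y (fderiv ℝ Y y u)) := by
    intro u
    have : VectorField.lieBracket ℝ X Y
        = fun z => fderiv ℝ Y z (X z) - fderiv ℝ X z (Y z) := rfl
    rw [this, fderiv_fun_sub (hY1.clm_apply hX0) (hX1.clm_apply hY0)]
    simp only [sub_apply, fderiv_apply_one hY1 hX0, fderiv_apply_one hX1 hY0]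
  rw [hd, hd]
  -- What is expanded here is L_[X,Y] B = L_X L_Y B - L_Y L_X B = c'cB - cc'B = 0. The second
  -- derivatives of B, X and Y are ordered by Schwarz so that they match.
  have e1 := h.fderiv_eqn hU hB hX hy (Y y) v w
  have e2 := h'.fderiv_eqn hU hB hY hy (X y) v w
  have s := ContDiffOn.fderiv_fderiv_comm hB hU hy (X y) (Y y)
  rw [ContDiffOn.fderiv_fderiv_comm hX hU hy (Y y) v,
    ContDiffOn.fderiv_fderiv_comm hX hU hy (Y y) w, ← s] at e1
  rw [ContDiffOn.fderiv_fderiv_comm hY hU hy (X y) v,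
    ContDiffOn.fderiv_fderiv_comm hY hU hy (X y) w] at e2
  have f1 := h y hy (fderiv ℝ Y y v) w
  have f2 := h y hy v (fderiv ℝ Y y w)
  have f3 := h' y hy (fderiv ℝ X y v) w
  have f4 := h' y hy v (fderiv ℝ X y w)
  have f5 := h y hy v w
  have f6 := h' y hy v w
  simp only [VectorField.lieBracket, map_sub, map_add, sub_apply, add_apply] at *
  linear_combination e2 - e1 + f3 + f4 - f1 - f2 + c' * f5 - c * f6

end

namespace IsLeviCivita

variable {U : Set E} {B : E → E →L[ℝ] E →L[ℝ] ℝ} {Γ : E → E →L[ℝ] E →L[ℝ] E} {X Y : E → E}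
  {c c' : ℝ} {y : E}

theorem ext (h : IsLeviCivita U B Γ) (hy : y ∈ U) {v w : E} (hvw : ∀ z, B y v z = B y w z) :
    v = w := by
  rw [← sub_eq_zero]
  refine h.nondeg y hy _ fun z => ?_
  simp [hvw z]

theorem fderiv_symm (h : IsLeviCivita U B Γ) (hy : y ∈ U) (a v w : E) :
    fderiv ℝ B y a v w = fderiv ℝ B y a w v :=
  fderiv_symm_of_symm h.isOpen h.smooth_metric h.symm hy a v w

theorem conn_symm (h : IsLeviCivita U B Γ) (hy : y ∈ U) (v w : E) : Γ y v w = Γ y w v := by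
  refine h.ext hy fun z => ?_
  rw [h.koszul y hy, h.koszul y hy, h.fderiv_symm hy z v w]
  ring

theorem fderiv_conn_symm (h : IsLeviCivita U B Γ) (hy : y ∈ U) (a v w : E) :
    fderiv ℝ Γ y a v w = fderiv ℝ Γ y a w v :=
  fderiv_symm_of_symm h.isOpen h.smooth_conn (fun _ hz => h.conn_symm hz) hy a v w

/-- In the sum of Koszul's formulas for (u, v, w) and (u, w, v) all derivatives cancel except the
one along u. -/
theorem metric_compat (h : IsLeviCivita U B Γ) (hy : y ∈ U) (u v w : E) :
    fderiv ℝ B y u v w = B y (Γ y u v) w + B y v (Γ y u w) := by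
  have e1 := h.koszul y hy u v w
  have e2 := h.koszul y hy u w v
  rw [h.fderiv_symm hy w u v] at e1
  rw [h.fderiv_symm hy u w v, h.fderiv_symm hy w u v, h.fderiv_symm hy v u w] at e2
  rw [h.fderiv_symm hy v u w] at e1
  linear_combination -e1 - e2 + h.symm y hy (Γ y u w) v

/-- Differentiating Koszul's formula expresses ∂Γ through second derivatives of B without ever
differentiating an inverse metric. -/
theorem fderiv_koszul (h : IsLeviCivita U B Γ) (hy : y ∈ U) (u v w z : E) :
    fderiv ℝ B y u (Γ y v w) z + B y (fderiv ℝ Γ y u v w) z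
      = (1 / 2) * (fderiv ℝ (fderiv ℝ B) y u v w z + fderiv ℝ (fderiv ℝ B) y u w v z
        - fderiv ℝ (fderiv ℝ B) y u z v w) := by
  have hB0 := ContDiffOn.differentiableAt_of_isOpen h.smooth_metric h.isOpen hy
  have hΓ0 := ContDiffOn.differentiableAt_of_isOpen h.smooth_conn h.isOpen hy
  have hB1 := ContDiffOn.differentiableAt_of_isOpen
    (ContDiffOn.fderiv_of_smooth h.smooth_metric h.isOpen) h.isOpen hy
  have hΓc : DifferentiableAt ℝ (fun x => Γ x v w) y :=
    (hΓ0.clm_apply (by fun_prop)).clm_apply (by fun_prop)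
  have hBc : ∀ a b d : E, DifferentiableAt ℝ (fun x => fderiv ℝ B x a b d) y := fun a b d =>
    ((hB1.clm_apply (by fun_prop)).clm_apply (by fun_prop)).clm_apply (by fun_prop)
  have key : (fun x => B x (Γ x v w) z) =ᶠ[𝓝 y] fun x =>
      (1 / 2) * (fderiv ℝ B x v w z + fderiv ℝ B x w v z - fderiv ℝ B x z v w) := by
    filter_upwards [h.isOpen.mem_nhds hy] with x hx using h.koszul x hx v w z
  have := congrArg (fun f : E →L[ℝ] ℝ => f u) key.fderiv_eq
  rw [fderiv_apply_two (Y := fun _ => z) hB0 hΓc (by fun_prop), fderiv_apply_const hΓ0,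
    fderiv_const_mul (((hBc _ _ _).fun_add (hBc _ _ _)).fun_sub (hBc _ _ _)),
    fderiv_fun_sub ((hBc _ _ _).fun_add (hBc _ _ _)) (hBc _ _ _),
    fderiv_fun_add (hBc _ _ _) (hBc _ _ _)] at this
  simpa [fderiv_apply_fderiv_const hB1] using this

/-- Metric compatibility turns the first-order terms of the differentiated Koszul formula into
products of two Γ. What remains displays the symmetries of the curvature. -/
theorem curvDown_eq (h : IsLeviCivita U B Γ) (hy : y ∈ U) (z w u v : E) :
    curvDown B Γ y z w u v =
      (1 / 2) * (fderiv ℝ (fderiv ℝ B) y u w v z - fderiv ℝ (fderiv ℝ B) y u z v w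
        - fderiv ℝ (fderiv ℝ B) y v w u z + fderiv ℝ (fderiv ℝ B) y v z u w)
      - B y (Γ y v w) (Γ y u z) + B y (Γ y u w) (Γ y v z) := by
  have e1 := h.fderiv_koszul hy u v w z
  have e2 := h.fderiv_koszul hy v u w z
  rw [h.metric_compat hy] at e1 e2
  rw [curvDown, h.symm y hy, curv]
  have s := congrArg (fun f : E →L[ℝ] E →L[ℝ] ℝ => f w z)
    (ContDiffOn.fderiv_fderiv_comm h.smooth_metric h.isOpen hy u v)
  simp only [map_sub, map_add, sub_apply, add_apply] at s ⊢
  linear_combination e1 - e2 + (1 / 2) * s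

/-- The explicit formula is visibly invariant under the exchange, because second derivatives commute
and B and Γ are symmetric. No Bianchi identity is needed. -/
theorem curvDown_pair (h : IsLeviCivita U B Γ) (hy : y ∈ U) (a b c d : E) :
    curvDown B Γ y a b c d = curvDown B Γ y c d a b := by
  have s1 := fun a b => ContDiffOn.fderiv_fderiv_comm h.smooth_metric h.isOpen hy a b
  have s2 := fderiv_fderiv_symm_of_symm h.isOpen h.smooth_metric h.symm hy
  rw [h.curvDown_eq hy, h.curvDown_eq hy, s1 a d, s2 d a b c, s1 a c, s2 c a b d, s1 b d,
    s2 d b a c, s1 b c, s2 c b a d, h.conn_symm hy b d, h.conn_symm hy a c, h.conn_symm hy a d,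
    h.conn_symm hy b c, h.symm y hy (Γ y d a)]
  ring

/-- Homothetic fields are affine: `L_X Γ = 0`. -/
theorem lie_conn (h : IsLeviCivita U B Γ) (hX : ContDiffOn ℝ ∞ X U) (hh : IsHomotheticOn U B X c)
    (hy : y ∈ U) (v w : E) :
    fderiv ℝ (fderiv ℝ X) y v w + fderiv ℝ Γ y (X y) v w - fderiv ℝ X y (Γ y v w)
      + Γ y (fderiv ℝ X y v) w + Γ y v (fderiv ℝ X y w) = 0 := by
  refine h.nondeg y hy _ fun z => ?_
  -- The Koszul combination of the derivatives of L_X B = cB along v, w and z is compared with the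
  -- derivative of Koszul's formula along X. The constant c, not being differentiated, cancels.
  have e1 := hh.fderiv_eqn h.isOpen h.smooth_metric hX hy v w z
  have e2 := hh.fderiv_eqn h.isOpen h.smooth_metric hX hy w v z
  have e3 := hh.fderiv_eqn h.isOpen h.smooth_metric hX hy z v w
  have f := h.fderiv_koszul hy (X y) v w z
  have k1 := h.koszul y hy (fderiv ℝ X y v) w z
  have k2 := h.koszul y hy v (fderiv ℝ X y w) z
  have k3 := h.koszul y hy v w z
  have k4 := h.koszul y hy v w (fderiv ℝ X y z)
  have l := hh y hy (Γ y v w) z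
  have s1 := fun a b => ContDiffOn.fderiv_fderiv_comm h.smooth_metric h.isOpen hy a b
  have t1 := fun a b => ContDiffOn.fderiv_fderiv_comm hX h.isOpen hy a b
  have s' := fun a v w => congrArg (fun f : E →L[ℝ] E →L[ℝ] ℝ => f v w) (s1 a (X y))
  have u1 := congrArg (fun a => B y a z) (t1 w v)
  have u2 := congrArg (fun a => B y a w) (t1 z v)
  have u3 := congrArg (B y v) (t1 w z)
  have u4 := h.symm y hy w (fderiv ℝ (fderiv ℝ X) y v z)
  have s1 := s' v w z
  have s2 := s' w v z
  have s3 := s' z v w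
  simp only [map_sub, map_add, sub_apply, add_apply] at *
  linear_combination (1 / 2) * (e1 + e2 - e3) + f - l + k1 + k2 + k4 - c * k3
    - (1 / 2) * (s1 + s2 - s3) - (1 / 2) * (u1 - u2 + u3 + u4)

end IsLeviCivita

end Local

/-! ### Covariant derivatives along geodesics and the Jacobi equation -/

section Curves

variable {E : Type*} [NormedAddCommGroup E] [NormedSpace ℝ E]
variable {U : Set E} {B : E → E →L[ℝ] E →L[ℝ] ℝ} {Γ : E → E →L[ℝ] E →L[ℝ] E} {X Y : E → E}
  {c c' : ℝ} {y : E} {q p : ℝ → E} {t : ℝ}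

theorem hasDerivAt_comp_curve {F : Type*} [NormedAddCommGroup F] [NormedSpace ℝ F] {f : E → F}
    (hf : ContDiffOn ℝ ∞ f U) (hU : IsOpen U) {p : E} (hq : HasDerivAt q p t) (hqU : q t ∈ U) :
    HasDerivAt (fun s => f (q s)) (fderiv ℝ f (q t) p) t :=
  (ContDiffOn.differentiableAt_of_isOpen hf hU hqU).hasFDerivAt.comp_hasDerivAt t hq

theorem hasDerivAt_apply_two {F₁ F₂ F₃ : Type*} [NormedAddCommGroup F₁] [NormedSpace ℝ F₁]
    [NormedAddCommGroup F₂] [NormedSpace ℝ F₂] [NormedAddCommGroup F₃] [NormedSpace ℝ F₃]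
    {A : ℝ → F₁ →L[ℝ] F₂ →L[ℝ] F₃} {A' : F₁ →L[ℝ] F₂ →L[ℝ] F₃} {a : ℝ → F₁} {a' : F₁}
    {b : ℝ → F₂} {b' : F₂} (hA : HasDerivAt A A' t) (ha : HasDerivAt a a' t)
    (hb : HasDerivAt b b' t) :
    HasDerivAt (fun s => A s (a s) (b s)) (A' (a t) (b t) + A t a' (b t) + A t (a t) b') t := by
  simpa using (hA.clm_apply ha).clm_apply hb

/-- The derivative in the direction `r` of the curvature of a connection. -/
def curvDeriv (Γ : E → E →L[ℝ] E →L[ℝ] E) (y r u v w : E) : E :=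
  fderiv ℝ (fderiv ℝ Γ) y r u v w - fderiv ℝ (fderiv ℝ Γ) y r v u w
    + (fderiv ℝ Γ y r u (Γ y v w) + Γ y u (fderiv ℝ Γ y r v w))
    - (fderiv ℝ Γ y r v (Γ y u w) + Γ y v (fderiv ℝ Γ y r u w))

theorem hasDerivAt_curv (hU : IsOpen U) (hΓ : ContDiffOn ℝ ∞ Γ U) {p : E}
    (hq : HasDerivAt q p t) (hqU : q t ∈ U) {u v w : ℝ → E} {u' v' w' : E}
    (hu : HasDerivAt u u' t) (hv : HasDerivAt v v' t) (hw : HasDerivAt w w' t) :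
    HasDerivAt (fun s => curv Γ (q s) (u s) (v s) (w s))
      (curvDeriv Γ (q t) p (u t) (v t) (w t) + curv Γ (q t) u' (v t) (w t)
        + curv Γ (q t) (u t) v' (w t) + curv Γ (q t) (u t) (v t) w') t := by
  have h0 := hasDerivAt_comp_curve hΓ hU hq hqU
  have h1 := hasDerivAt_comp_curve (ContDiffOn.fderiv_of_smooth hΓ hU) hU hq hqU
  have e1 := hasDerivAt_apply_two (h1.clm_apply hu) hv hw
  have e2 := hasDerivAt_apply_two (h1.clm_apply hv) hu hw
  have e3 := hasDerivAt_apply_two h0 hu (hasDerivAt_apply_two h0 hv hw)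
  have e4 := hasDerivAt_apply_two h0 hv (hasDerivAt_apply_two h0 hu hw)
  refine (((e1.fun_sub e2).fun_add e3).fun_sub e4).congr_deriv ?_
  simp only [curv, curvDeriv, map_add, add_apply]
  abel

theorem fderiv_curvDown (hU : IsOpen U) (hB : ContDiffOn ℝ ∞ B U) (hΓ : ContDiffOn ℝ ∞ Γ U)
    (hy : y ∈ U) (r a b c d : E) :
    fderiv ℝ (fun z => curvDown B Γ z a b c d) y r
      = fderiv ℝ B y r a (curv Γ y c d b) + B y a (curvDeriv Γ y r c d b) := by
  have hB0 := ContDiffOn.differentiableAt_of_isOpen hB hU hy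
  have hΓ0 := ContDiffOn.differentiableAt_of_isOpen hΓ hU hy
  have hΓ1 := ContDiffOn.differentiableAt_of_isOpen (ContDiffOn.fderiv_of_smooth hΓ hU) hU hy
  have hc : ∀ u v w : E, DifferentiableAt ℝ (fun z => fderiv ℝ Γ z u v w) y := fun u v w =>
    ((hΓ1.clm_apply (by fun_prop)).clm_apply (by fun_prop)).clm_apply (by fun_prop)
  have hg : ∀ u v w : E, DifferentiableAt ℝ (fun z => Γ z u (Γ z v w)) y := fun u v w =>
    (hΓ0.clm_apply (by fun_prop)).clm_apply
      ((hΓ0.clm_apply (by fun_prop)).clm_apply (by fun_prop))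
  have hd : DifferentiableAt ℝ (fun z => curvDown B Γ z a b c d) y :=
    (hB0.clm_apply (by fun_prop)).clm_apply
      ((((hc _ _ _).sub (hc _ _ _)).add (hg _ _ _)).sub (hg _ _ _))
  -- The directional derivative is read off from the product rule along the straight line through y
  -- with constant arguments, by uniqueness of derivatives.
  have hl : HasDerivAt (fun s : ℝ => y + s • r) r 0 := by
    simpa using ((hasDerivAt_id (0 : ℝ)).smul_const r).const_add y
  have hl0 : y + (0 : ℝ) • r = y := by simp
  have hk := fun x : E => hasDerivAt_const (0 : ℝ) x
  have e1 := hasDerivAt_apply_two (hasDerivAt_comp_curve hB hU hl (by simpa using hy)) (hk a)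
    (hasDerivAt_curv hU hΓ hl (by simpa using hy) (hk c) (hk d) (hk b))
  have e2 : HasDerivAt (fun s : ℝ => curvDown B Γ (y + s • r) a b c d)
      (fderiv ℝ (fun z => curvDown B Γ z a b c d) y r) 0 := by
    have := hd.hasFDerivAt
    rw [← hl0] at this
    exact (this.comp_hasDerivAt (0 : ℝ) hl).congr_deriv (by rw [hl0])
  rw [e2.unique e1]
  simp [curv]

/-- The covariant Leibniz rule: the four Γ terms subtracted in `nablaCurv` are restored by
completing the derivatives of the arguments to covariant ones. -/
theorem hasDerivAt_curvDown (hU : IsOpen U) (hB : ContDiffOn ℝ ∞ B U) (hΓ : ContDiffOn ℝ ∞ Γ U)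
    {p : E} (hq : HasDerivAt q p t) (hqU : q t ∈ U) {a b u v : ℝ → E} {a' b' u' v' : E}
    (ha : HasDerivAt a a' t) (hb : HasDerivAt b b' t) (hu : HasDerivAt u u' t)
    (hv : HasDerivAt v v' t) :
    HasDerivAt (fun s => curvDown B Γ (q s) (a s) (b s) (u s) (v s))
      (nablaCurv B Γ (q t) p (a t) (b t) (u t) (v t)
        + curvDown B Γ (q t) (a' + Γ (q t) p (a t)) (b t) (u t) (v t)
        + curvDown B Γ (q t) (a t) (b' + Γ (q t) p (b t)) (u t) (v t)
        + curvDown B Γ (q t) (a t) (b t) (u' + Γ (q t) p (u t)) (v t)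
        + curvDown B Γ (q t) (a t) (b t) (u t) (v' + Γ (q t) p (v t))) t := by
  refine (hasDerivAt_apply_two (hasDerivAt_comp_curve hB hU hq hqU) ha
    (hasDerivAt_curv hU hΓ hq hqU hu hv hb)).congr_deriv ?_
  rw [nablaCurv, fderiv_curvDown hU hB hΓ hqU]
  simp only [curvDown, curv, map_add, map_sub, add_apply]
  ring

/-- The covariant derivative of the metric vanishes along curves. -/
theorem IsLeviCivita.hasDerivAt_metric (h : IsLeviCivita U B Γ) {p : E} (hq : HasDerivAt q p t)
    (hqU : q t ∈ U) {a b : ℝ → E} {a' b' : E} (ha : HasDerivAt a a' t) (hb : HasDerivAt b b' t) :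
    HasDerivAt (fun s => B (q s) (a s) (b s))
      (B (q t) (a' + Γ (q t) p (a t)) (b t) + B (q t) (a t) (b' + Γ (q t) p (b t))) t := by
  refine (hasDerivAt_apply_two (hasDerivAt_comp_curve h.smooth_metric h.isOpen hq hqU)
    ha hb).congr_deriv ?_
  rw [h.metric_compat hqU]
  simp only [map_add, add_apply]
  ring

/-- The covariant derivative `∇_r X`. -/
def covDeriv (Γ : E → E →L[ℝ] E →L[ℝ] E) (X : E → E) (y r : E) : E :=
  fderiv ℝ X y r + Γ y r (X y)

/-- A homothetic field satisfies the Jacobi equation along geodesics. -/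
theorem IsLeviCivita.hasDerivAt_covDeriv (h : IsLeviCivita U B Γ) (hX : ContDiffOn ℝ ∞ X U)
    (hh : IsHomotheticOn U B X c) (hqU : q t ∈ U) (hq : HasDerivAt q (p t) t)
    (hp : HasDerivAt p (-Γ (q t) (p t) (p t)) t) :
    HasDerivAt (fun s => covDeriv Γ X (q s) (p s))
      (-curv Γ (q t) (X (q t)) (p t) (p t) - Γ (q t) (p t) (covDeriv Γ X (q t) (p t))) t := by
  have hX1 := hasDerivAt_comp_curve (ContDiffOn.fderiv_of_smooth hX h.isOpen) h.isOpen hq hqU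
  have hX0 := hasDerivAt_comp_curve hX h.isOpen hq hqU
  have hΓ0 := hasDerivAt_comp_curve h.smooth_conn h.isOpen hq hqU
  refine ((hX1.clm_apply hp).fun_add (hasDerivAt_apply_two hΓ0 hp hX0)).congr_deriv ?_
  -- Subtracting L_X Γ = 0, evaluated on (p, p), removes the second derivative of X and leaves
  -- exactly the curvature term.
  have l := h.lie_conn hX hh hqU (p t) (p t)
  rw [h.conn_symm hqU (fderiv ℝ X (q t) (p t))] at l
  have s := h.conn_symm hqU (X (q t)) (Γ (q t) (p t) (p t))
  have s' := h.conn_symm hqU (X (q t)) (p t)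
  rw [← sub_eq_zero, ← l, curv, covDeriv, s, s',
    h.fderiv_conn_symm hqU _ (p t) (X (q t))]
  simp only [map_add, map_neg, neg_apply]
  abel

/-- The third derivative of the product of two homothetic fields along a geodesic. -/
theorem IsLeviCivita.iteratedDeriv_three_metric (h : IsLeviCivita U B Γ) (hX : ContDiffOn ℝ ∞ X U)
    (hY : ContDiffOn ℝ ∞ Y U) (hhX : IsHomotheticOn U B X c) (hhY : IsHomotheticOn U B Y c')
    {N : Set ℝ} (hN : IsOpen N) (hqU : ∀ s ∈ N, q s ∈ U) (hq : ∀ s ∈ N, HasDerivAt q (p s) s)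
    (hp : ∀ s ∈ N, HasDerivAt p (-Γ (q s) (p s) (p s)) s) (ht : t ∈ N) :
    iteratedDeriv 3 (fun s => B (q s) (X (q s)) (Y (q s))) t
      = -2 * (2 * curvDown B Γ (q t) (covDeriv Γ Y (q t) (p t)) (p t) (X (q t)) (p t)
        + 2 * curvDown B Γ (q t) (covDeriv Γ X (q t) (p t)) (p t) (Y (q t)) (p t)
        + nablaCurv B Γ (q t) (p t) (X (q t)) (p t) (Y (q t)) (p t)) := by
  have d0 : ∀ s ∈ N, HasDerivAt (fun s => B (q s) (X (q s)) (Y (q s)))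
      (B (q s) (covDeriv Γ X (q s) (p s)) (Y (q s))
        + B (q s) (X (q s)) (covDeriv Γ Y (q s) (p s))) s := fun s hs =>
    h.hasDerivAt_metric (hq s hs) (hqU s hs)
      (hasDerivAt_comp_curve hX h.isOpen (hq s hs) (hqU s hs))
      (hasDerivAt_comp_curve hY h.isOpen (hq s hs) (hqU s hs))
  -- The Jacobi equation for X and the one for Y each contribute a curvature term. Pair symmetry
  -- makes the two equal, whence the factor 2.
  have d1 : ∀ s ∈ N, HasDerivAt (fun s => B (q s) (covDeriv Γ X (q s) (p s)) (Y (q s))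
        + B (q s) (X (q s)) (covDeriv Γ Y (q s) (p s)))
      (2 * B (q s) (covDeriv Γ X (q s) (p s)) (covDeriv Γ Y (q s) (p s))
        - 2 * curvDown B Γ (q s) (X (q s)) (p s) (Y (q s)) (p s)) s := by
    intro s hs
    have hX0 := hasDerivAt_comp_curve hX h.isOpen (hq s hs) (hqU s hs)
    have hY0 := hasDerivAt_comp_curve hY h.isOpen (hq s hs) (hqU s hs)
    have hX1 := h.hasDerivAt_covDeriv hX hhX (hqU s hs) (hq s hs) (hp s hs)
    have hY1 := h.hasDerivAt_covDeriv hY hhY (hqU s hs) (hq s hs) (hp s hs)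
    refine ((h.hasDerivAt_metric (hq s hs) (hqU s hs) hX1 hY0).fun_add
      (h.hasDerivAt_metric (hq s hs) (hqU s hs) hX0 hY1)).congr_deriv ?_
    have e := h.curvDown_pair (hqU s hs) (X (q s)) (p s) (Y (q s)) (p s)
    have e' := h.symm _ (hqU s hs) (curv Γ (q s) (X (q s)) (p s) (p s)) (Y (q s))
    simp only [curvDown, covDeriv, map_add, map_sub, map_neg, add_apply, sub_apply,
      neg_apply] at e e' ⊢
    linear_combination e - e'
  have d2 : ∀ s ∈ N, HasDerivAt
      (fun s => 2 * B (q s) (covDeriv Γ X (q s) (p s)) (covDeriv Γ Y (q s) (p s))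
        - 2 * curvDown B Γ (q s) (X (q s)) (p s) (Y (q s)) (p s))
      (-2 * (2 * curvDown B Γ (q s) (covDeriv Γ Y (q s) (p s)) (p s) (X (q s)) (p s)
        + 2 * curvDown B Γ (q s) (covDeriv Γ X (q s) (p s)) (p s) (Y (q s)) (p s)
        + nablaCurv B Γ (q s) (p s) (X (q s)) (p s) (Y (q s)) (p s))) s := by
    intro s hs
    have hX0 := hasDerivAt_comp_curve hX h.isOpen (hq s hs) (hqU s hs)
    have hY0 := hasDerivAt_comp_curve hY h.isOpen (hq s hs) (hqU s hs)
    have hX1 := h.hasDerivAt_covDeriv hX hhX (hqU s hs) (hq s hs) (hp s hs)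
    have hY1 := h.hasDerivAt_covDeriv hY hhY (hqU s hs) (hq s hs) (hp s hs)
    refine (((h.hasDerivAt_metric (hq s hs) (hqU s hs) hX1 hY1).const_mul 2).fun_sub
      ((hasDerivAt_curvDown h.isOpen h.smooth_metric h.smooth_conn (hq s hs) (hqU s hs) hX0
        (hp s hs) hY0 (hp s hs)).const_mul 2)).congr_deriv ?_
    have e := h.curvDown_pair (hqU s hs) (X (q s)) (p s) (covDeriv Γ Y (q s) (p s)) (p s)
    have e' := h.symm _ (hqU s hs) (curv Γ (q s) (X (q s)) (p s) (p s))
      (covDeriv Γ Y (q s) (p s))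
    -- The velocity of a geodesic is parallel, so the second and fourth slots of the curvature
    -- contribute nothing.
    have z : ∀ a b c : E, curvDown B Γ (q s) a 0 b c = 0 := by simp [curvDown, curv]
    have z' : ∀ a b c : E, curvDown B Γ (q s) a b c 0 = 0 := by simp [curvDown, curv]
    rw [neg_add_cancel, z, z', sub_add_cancel, sub_add_cancel]
    rw [show fderiv ℝ X (q s) (p s) + Γ (q s) (p s) (X (q s)) = covDeriv Γ X (q s) (p s) from rfl,
      show fderiv ℝ Y (q s) (p s) + Γ (q s) (p s) (Y (q s)) = covDeriv Γ Y (q s) (p s) from rfl, e]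
    simp only [curvDown, map_neg, neg_apply, e']
    ring
  have e0 : ∀ s ∈ N, deriv (fun s => B (q s) (X (q s)) (Y (q s))) s = _ := fun s hs =>
    (d0 s hs).deriv
  have e1 : ∀ s ∈ N, deriv (deriv fun s => B (q s) (X (q s)) (Y (q s))) s = _ := fun s hs => by
    rw [Filter.EventuallyEq.deriv_eq (Filter.eventuallyEq_of_mem (hN.mem_nhds hs) e0),
      (d1 s hs).deriv]
  rw [iteratedDeriv_succ, iteratedDeriv_succ, iteratedDeriv_one,
    Filter.EventuallyEq.deriv_eq (Filter.eventuallyEq_of_mem (hN.mem_nhds ht) e1),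
    (d2 t ht).deriv]

end Curves

/-! ### Components of tensors in the standard basis -/

section Components

variable {n : ℕ}

/-- The standard basis of the coordinate space. -/
abbrev basisVec (μ : Fin n) : Coord n := EuclideanSpace.single μ 1

theorem sum_smul_basisVec (v : Coord n) : ∑ μ, v μ • basisVec μ = v := by
  ext ν
  simp [basisVec, Finset.sum_apply, Pi.single_apply]

theorem isLinearMap_sum_basis {F : Type*} [AddCommGroup F] [Module ℝ F] {f : Coord n → F}
    (hf : IsLinearMap ℝ f) (v : Coord n) : f v = ∑ μ, v μ • f (basisVec μ) := by
  conv_lhs => rw [← sum_smul_basisVec v]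
  exact (map_sum (hf.mk' f) _ _).trans (Finset.sum_congr rfl fun μ _ => hf.map_smul _ _)

theorem isLinearMap_ext_basis {F : Type*} [AddCommGroup F] [Module ℝ F] {f f' : Coord n → F}
    (hf : IsLinearMap ℝ f) (hf' : IsLinearMap ℝ f')
    (h : ∀ μ, f (basisVec μ) = f' (basisVec μ)) (v : Coord n) : f v = f' v := by
  rw [isLinearMap_sum_basis hf, isLinearMap_sum_basis hf']
  simp [h]

theorem sum_apply_basisVec {F : Type*} [NormedAddCommGroup F] [NormedSpace ℝ F]
    (L : Coord n →L[ℝ] F) (v : Coord n) : ∑ μ, v μ • L (basisVec μ) = L v :=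
  (isLinearMap_sum_basis L.toLinearMap.isLinear v).symm

/-- The matrix of components of a field of bilinear forms. -/
def formMatrix (B : Coord n → Coord n →L[ℝ] Coord n →L[ℝ] ℝ) (y : Coord n) :
    Matrix (Fin n) (Fin n) ℝ :=
  Matrix.of fun μ ν => B y (basisVec μ) (basisVec ν)

/-- The Christoffel symbols as a field of bilinear maps. -/
def conn (G : Coord n → Matrix (Fin n) (Fin n) ℝ) (y : Coord n) :
    Coord n →L[ℝ] Coord n →L[ℝ] Coord n :=
  ∑ ρ, ∑ μ, ∑ ν, christoffel G ρ μ ν y • (EuclideanSpace.proj μ : Coord n →L[ℝ] ℝ).smulRight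
    ((EuclideanSpace.proj ν : Coord n →L[ℝ] ℝ).smulRight (basisVec ρ))

theorem conn_apply (G : Coord n → Matrix (Fin n) (Fin n) ℝ) (y v w : Coord n) (ρ : Fin n) :
    conn G y v w ρ = ∑ μ, ∑ ν, christoffel G ρ μ ν y * (v μ * w ν) := by
  simp only [conn, FunLike.coe_sum, Finset.sum_apply, FunLike.coe_smul, Pi.smul_apply,
    ContinuousLinearMap.smulRight_apply, EuclideanSpace.coe_proj, WithLp.ofLp_sum,
    WithLp.ofLp_smul, PiLp.ofLp_single, smul_eq_mul]
  rw [Finset.sum_eq_single ρ]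
  · simp
  · intro b _ hb
    simp [hb.symm]
  · simp

theorem conn_basisVec_left (G : Coord n → Matrix (Fin n) (Fin n) ℝ) (y w : Coord n)
    (ρ μ : Fin n) :
    conn G y (basisVec μ) w ρ = ∑ ν, christoffel G ρ μ ν y * w ν := by
  rw [conn_apply, Finset.sum_eq_single μ]
  · simp
  · intro b _ hb
    simp [hb]
  · simp

theorem conn_basisVec (G : Coord n → Matrix (Fin n) (Fin n) ℝ) (y : Coord n) (ρ μ ν : Fin n) :
    conn G y (basisVec μ) (basisVec ν) ρ = christoffel G ρ μ ν y := by
  rw [conn_basisVec_left, Finset.sum_eq_single ν]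
  · simp
  · intro b _ hb
    simp [hb]
  · simp

variable {U : Set (Coord n)} {B : Coord n → Coord n →L[ℝ] Coord n →L[ℝ] ℝ}

theorem pd_formMatrix (hU : IsOpen U) (hB : ContDiffOn ℝ ∞ B U) {y : Coord n} (hy : y ∈ U)
    (ρ μ ν : Fin n) :
    pd ρ (fun z => formMatrix B z μ ν) y
      = fderiv ℝ B y (basisVec ρ) (basisVec μ) (basisVec ν) :=
  fderiv_apply_const (ContDiffOn.differentiableAt_of_isOpen hB hU hy) _ _ _

theorem contDiffOn_formMatrix (hB : ContDiffOn ℝ ∞ B U) (μ ν : Fin n) :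
    ContDiffOn ℝ ∞ (fun y => formMatrix B y μ ν) U :=
  (hB.clm_apply contDiffOn_const).clm_apply contDiffOn_const

/-- A nonzero vector killed by the matrix would be a degenerate direction of the form. -/
theorem isUnit_det_formMatrix {y : Coord n} (hnd : ∀ v, (∀ w, B y v w = 0) → v = 0) :
    IsUnit (formMatrix B y).det := by
  rw [isUnit_iff_ne_zero]
  intro h0
  obtain ⟨v, hv, hv0⟩ := Matrix.exists_vecMul_eq_zero_iff.2 h0
  refine hv ?_
  have : (WithLp.toLp 2 v : Coord n) = 0 := by
    refine hnd _ fun w => ?_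
    refine isLinearMap_ext_basis (f := fun w => B y (WithLp.toLp 2 v) w) (f' := fun _ => (0 : ℝ))
      (B y _).toLinearMap.isLinear (0 : Coord n →ₗ[ℝ] ℝ).isLinear (fun ν => ?_) w
    have := congrFun hv0 ν
    rw [isLinearMap_sum_basis (f := fun u => B y u (basisVec ν))
      ⟨by simp, by simp⟩]
    simpa [Matrix.vecMul, dotProduct, formMatrix] using this
  simpa using congrArg WithLp.ofLp this

theorem contDiffOn_inv_matrix {G : Coord n → Matrix (Fin n) (Fin n) ℝ}
    (hG : ∀ μ ν, ContDiffOn ℝ ∞ (fun y => G y μ ν) U) (hd : ∀ y ∈ U, IsUnit (G y).det)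
    (μ ν : Fin n) : ContDiffOn ℝ ∞ (fun y => (G y)⁻¹ μ ν) U := by
  have hdet : ∀ G' : Coord n → Matrix (Fin n) (Fin n) ℝ,
      (∀ μ ν, ContDiffOn ℝ ∞ (fun y => G' y μ ν) U) → ContDiffOn ℝ ∞ (fun y => (G' y).det) U := by
    intro G' hG'
    simp only [Matrix.det_apply']
    exact ContDiffOn.sum fun σ _ => contDiffOn_const.mul (contDiffOn_prod fun i _ => hG' _ _)
  simp only [Matrix.inv_def, Matrix.smul_apply, Matrix.adjugate_apply, smul_eq_mul,
    Ring.inverse_eq_inv']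
  refine ((hdet G hG).inv fun y hy => (hd y hy).ne_zero).mul (hdet _ fun i j => ?_)
  -- By Cramer's rule the adjugate entry is the determinant of the matrix with row ν replaced by a
  -- constant basis row.
  by_cases h : i = ν
  · subst h
    simpa using! contDiffOn_const
  · simpa [Matrix.updateRow_ne h] using hG i j

theorem contDiffOn_conn (hU : IsOpen U) (hB : ContDiffOn ℝ ∞ B U)
    (hnd : ∀ y ∈ U, ∀ v, (∀ w, B y v w = 0) → v = 0) :
    ContDiffOn ℝ ∞ (conn (formMatrix B)) U := by
  have hpd : ∀ ρ μ ν : Fin n, ContDiffOn ℝ ∞ (fun y => pd ρ (fun z => formMatrix B z μ ν) y) U :=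
    fun ρ μ ν => (ContDiffOn.fderiv_of_smooth (contDiffOn_formMatrix hB μ ν) hU).clm_apply
      contDiffOn_const
  have hinv := contDiffOn_inv_matrix (contDiffOn_formMatrix hB)
    fun y hy => isUnit_det_formMatrix (hnd y hy)
  refine ContDiffOn.sum fun ρ _ => ContDiffOn.sum fun μ _ => ContDiffOn.sum fun ν _ =>
    ContDiffOn.fun_smul ?_ contDiffOn_const
  exact contDiffOn_const.mul (ContDiffOn.sum fun σ _ => (hinv ρ σ).mul
    (((hpd _ _ _).add (hpd _ _ _)).sub (hpd _ _ _)))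

/-- The Christoffel symbols define the Levi-Civita connection. -/
theorem isLeviCivita_conn (hU : IsOpen U) (hB : ContDiffOn ℝ ∞ B U)
    (hs : ∀ y ∈ U, ∀ v w, B y v w = B y w v)
    (hnd : ∀ y ∈ U, ∀ v, (∀ w, B y v w = 0) → v = 0) :
    IsLeviCivita U B (conn (formMatrix B)) where
  isOpen := hU
  smooth_metric := hB
  smooth_conn := contDiffOn_conn hU hB hnd
  symm := hs
  nondeg := hnd
  koszul y hy v w z := by
    have hb : ∀ μ ν σ : Fin n,
        B y (conn (formMatrix B) y (basisVec μ) (basisVec ν)) (basisVec σ)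
          = (1 / 2) * (fderiv ℝ B y (basisVec μ) (basisVec ν) (basisVec σ)
            + fderiv ℝ B y (basisVec ν) (basisVec μ) (basisVec σ)
            - fderiv ℝ B y (basisVec σ) (basisVec μ) (basisVec ν)) := by
      intro μ ν σ
      have hG := Matrix.mul_nonsing_inv _ (isUnit_det_formMatrix (hnd y hy))
      rw [isLinearMap_sum_basis (f := fun u => B y u (basisVec σ)) ⟨by simp, by simp⟩]
      simp only [conn_basisVec, christoffel, pd_formMatrix hU hB hy]
      rw [fderiv_symm_of_symm hU hB hs hy _ (basisVec ν) (basisVec σ),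
        fderiv_symm_of_symm hU hB hs hy _ (basisVec μ) (basisVec σ)]
      -- The inverse metric in the Christoffel symbol cancels against the metric that lowers its
      -- upper index.
      have hsum : ∀ t : Fin n → ℝ, ∑ ρ, (∑ τ, (formMatrix B y)⁻¹ ρ τ * t τ)
          * B y (basisVec ρ) (basisVec σ) = t σ := by
        intro t
        simp only [Finset.sum_mul]
        rw [Finset.sum_comm]
        have : ∀ τ, ∑ ρ, (formMatrix B y)⁻¹ ρ τ * t τ * B y (basisVec ρ) (basisVec σ)
            = (1 : Matrix (Fin n) (Fin n) ℝ) σ τ * t τ := by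
          intro τ
          rw [← hG, Matrix.mul_apply, Finset.sum_mul]
          refine Finset.sum_congr rfl fun ρ _ => ?_
          rw [hs y hy (basisVec ρ)]
          simp only [formMatrix, Matrix.of_apply]
          ring
        simp only [this]
        simp [Matrix.one_apply]
      simp only [smul_eq_mul, mul_assoc, ← Finset.mul_sum]
      exact congrArg (1 / 2 * ·) (hsum fun τ => _)
    -- Koszul's formula is now extended from basis vectors to all vectors, one slot at a time.
    have h1 : ∀ v, ∀ ν σ : Fin n, B y (conn (formMatrix B) y v (basisVec ν)) (basisVec σ)
          = (1 / 2) * (fderiv ℝ B y v (basisVec ν) (basisVec σ)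
            + fderiv ℝ B y (basisVec ν) v (basisVec σ)
            - fderiv ℝ B y (basisVec σ) v (basisVec ν)) := fun v ν σ =>
      isLinearMap_ext_basis
        (f := fun v => B y (conn (formMatrix B) y v (basisVec ν)) (basisVec σ))
        (f' := fun v => (1 / 2) * (fderiv ℝ B y v (basisVec ν) (basisVec σ)
          + fderiv ℝ B y (basisVec ν) v (basisVec σ)
          - fderiv ℝ B y (basisVec σ) v (basisVec ν)))
        ⟨by simp, by simp⟩ ⟨fun a b => by simp; ring, fun a b => by simp; ring⟩
        (fun μ => hb μ ν σ) v
    have h2 : ∀ v w, ∀ σ : Fin n, B y (conn (formMatrix B) y v w) (basisVec σ)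
          = (1 / 2) * (fderiv ℝ B y v w (basisVec σ) + fderiv ℝ B y w v (basisVec σ)
            - fderiv ℝ B y (basisVec σ) v w) := fun v w σ =>
      isLinearMap_ext_basis (f := fun w => B y (conn (formMatrix B) y v w) (basisVec σ))
        (f' := fun w => (1 / 2) * (fderiv ℝ B y v w (basisVec σ) + fderiv ℝ B y w v (basisVec σ)
          - fderiv ℝ B y (basisVec σ) v w))
        ⟨by simp, by simp⟩ ⟨fun a b => by simp; ring, fun a b => by simp; ring⟩
        (fun ν => h1 v ν σ) w
    exact isLinearMap_ext_basis (f := fun z => B y (conn (formMatrix B) y v w) z)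
      (f' := fun z => (1 / 2) * (fderiv ℝ B y v w z + fderiv ℝ B y w v z - fderiv ℝ B y z v w))
      ⟨by simp, by simp⟩ ⟨fun a b => by simp; ring, fun a b => by simp; ring⟩
      (fun σ => h2 v w σ) z

end Components

/-! ### Translation between index-free tensors and their components -/

section Dictionary

variable {n : ℕ} {U : Set (Coord n)} {B : Coord n → Coord n →L[ℝ] Coord n →L[ℝ] ℝ}
  {X Y : Coord n → Coord n} {y : Coord n} {c : ℝ}

/-- The components of a vector field on the coordinate space. -/
abbrev comps (X : Coord n → Coord n) : Fin n → Coord n → ℝ := fun μ y => X y μ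

theorem pd_comp {f : Coord n → Coord n} (hf : DifferentiableAt ℝ f y) (μ ρ : Fin n) :
    pd μ (fun z => f z ρ) y = fderiv ℝ f y (basisVec μ) ρ := by
  have := ((EuclideanSpace.proj ρ : Coord n →L[ℝ] ℝ).hasFDerivAt.comp y hf.hasFDerivAt).fderiv
  exact congrArg (fun L : Coord n →L[ℝ] ℝ => L (basisVec μ)) this

theorem nablaUp_eq (hX : DifferentiableAt ℝ X y) (ρ σ : Fin n) :
    nablaUp (formMatrix B) (comps X) ρ σ y
      = covDeriv (conn (formMatrix B)) X y (basisVec ρ) σ := by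
  rw [nablaUp, pd_comp hX, covDeriv, PiLp.add_apply, conn_basisVec_left]

theorem lower_eq (X : Coord n → Coord n) (μ : Fin n) (y : Coord n) :
    lower (formMatrix B) (comps X) μ y = B y (basisVec μ) (X y) := by
  rw [lower, ← sum_apply_basisVec]
  exact Finset.sum_congr rfl fun κ _ => mul_comm _ _

theorem isLinearMap_curvDown (Γ : Coord n → Coord n →L[ℝ] Coord n →L[ℝ] Coord n)
    (y a b u v : Coord n) :
    IsLinearMap ℝ (fun a => curvDown B Γ y a b u v) ∧
    IsLinearMap ℝ (fun b => curvDown B Γ y a b u v) ∧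
    IsLinearMap ℝ (fun u => curvDown B Γ y a b u v) ∧
    IsLinearMap ℝ (fun v => curvDown B Γ y a b u v) := by
  refine ⟨⟨fun _ _ => ?_, fun _ _ => ?_⟩, ⟨fun _ _ => ?_, fun _ _ => ?_⟩,
    ⟨fun _ _ => ?_, fun _ _ => ?_⟩, ⟨fun _ _ => ?_, fun _ _ => ?_⟩⟩ <;>
  · simp only [curvDown, curv, map_add, map_sub, map_smul, add_apply, smul_apply, smul_eq_mul]
    ring

namespace IsLeviCivita

theorem riemannUp_eq (h : IsLeviCivita U B (conn (formMatrix B)))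
    (hy : y ∈ U) (ρ σ μ ν : Fin n) :
    riemannUp (formMatrix B) ρ σ μ ν y
      = curv (conn (formMatrix B)) y (basisVec μ) (basisVec ν) (basisVec σ) ρ := by
  have hd := ContDiffOn.differentiableAt_of_isOpen h.smooth_conn h.isOpen hy
  have e : ∀ α β τ : Fin n, pd τ (christoffel (formMatrix B) ρ α β) y
      = fderiv ℝ (conn (formMatrix B)) y (basisVec τ) (basisVec α) (basisVec β) ρ := by
    intro α β τ
    rw [← fderiv_apply_const hd, ← pd_comp]
    · simp only [conn_basisVec]
    · exact (hd.clm_apply (by fun_prop)).clm_apply (by fun_prop)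
  rw [riemannUp, e, e, Finset.sum_sub_distrib]
  simp only [curv, PiLp.add_apply, PiLp.sub_apply, conn_basisVec_left _ _ (conn _ _ _ _),
    conn_basisVec]
  ring

theorem riemann_eq (h : IsLeviCivita U B (conn (formMatrix B)))
    (hy : y ∈ U) (ρ σ μ ν : Fin n) :
    riemann (formMatrix B) ρ σ μ ν y
      = curvDown B (conn (formMatrix B)) y (basisVec ρ) (basisVec σ) (basisVec μ)
        (basisVec ν) := by
  rw [curvDown, ← sum_apply_basisVec]
  refine Finset.sum_congr rfl fun κ _ => ?_
  rw [h.riemannUp_eq hy, smul_eq_mul, mul_comm]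
  rfl

/-- Lowering an index commutes with ∇, by metric compatibility. -/
theorem nablaDown_eq (h : IsLeviCivita U B (conn (formMatrix B)))
    (hy : y ∈ U) (hX : DifferentiableAt ℝ X y) (ν μ : Fin n) :
    nablaDown (formMatrix B) (lower (formMatrix B) (comps X)) ν μ y
      = B y (basisVec μ) (covDeriv (conn (formMatrix B)) X y (basisVec ν)) := by
  have hd := ContDiffOn.differentiableAt_of_isOpen h.smooth_metric h.isOpen hy
  have e : pd ν (lower (formMatrix B) (comps X) μ) y
      = fderiv ℝ B y (basisVec ν) (basisVec μ) (X y)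
        + B y (basisVec μ) (fderiv ℝ X y (basisVec ν)) := by
    have : lower (formMatrix B) (comps X) μ = fun z => B z (basisVec μ) (X z) := by
      ext z
      exact lower_eq X μ z
    rw [this, pd, fderiv_apply_two (X := fun _ => basisVec μ) hd (by fun_prop) hX]
    simp
  have e' : ∑ κ, christoffel (formMatrix B) κ ν μ y * lower (formMatrix B) (comps X) κ y
      = B y (conn (formMatrix B) y (basisVec ν) (basisVec μ)) (X y) := by
    rw [isLinearMap_sum_basis (f := fun u => B y u (X y)) ⟨by simp, by simp⟩]
    simp only [conn_basisVec, lower_eq, smul_eq_mul]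
  rw [nablaDown, e, e', h.metric_compat hy, covDeriv, map_add]
  ring

theorem symProduct_eq (h : IsLeviCivita U B (conn (formMatrix B)))
    (hy : y ∈ U) (hX : DifferentiableAt ℝ X y) (hY : DifferentiableAt ℝ Y y)
    (μ : Fin n) :
    symProduct (formMatrix B) (comps X) (comps Y) μ y
      = B y (basisVec μ) (covDeriv (conn (formMatrix B)) Y y (X y)
        + covDeriv (conn (formMatrix B)) X y (Y y)) := by
  have e : ∀ (Z : Coord n → Coord n) (v : Coord n),
      B y (basisVec μ) (covDeriv (conn (formMatrix B)) Z y v)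
        = ∑ ν, v ν * B y (basisVec μ) (covDeriv (conn (formMatrix B)) Z y (basisVec ν)) :=
    fun Z v => isLinearMap_sum_basis
      (f := fun u => B y (basisVec μ) (covDeriv (conn (formMatrix B)) Z y u))
      ⟨fun a b => by simp [covDeriv]; ring, fun a b => by simp [covDeriv]; ring⟩ v
  rw [symProduct, map_add, e, e, ← Finset.sum_add_distrib]
  simp only [h.nablaDown_eq hy hX, h.nablaDown_eq hy hY]

/-- For a torsion-free metric connection the symmetrised ∇X is the Lie derivative L_X B. The Lie
form is the convenient one for calculations, since it does not mention Γ. -/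
theorem isHomotheticOn_iff (h : IsLeviCivita U B (conn (formMatrix B)))
    (hX : ContDiffOn ℝ ∞ X U) :
    IsHomotheticOn U B X c ↔ ∀ y ∈ U, ∀ μ ν,
      nablaDown (formMatrix B) (lower (formMatrix B) (comps X)) μ ν y
        + nablaDown (formMatrix B) (lower (formMatrix B) (comps X)) ν μ y
        = c * formMatrix B y μ ν := by
  refine forall₂_congr fun y hy => ?_
  have hX0 := ContDiffOn.differentiableAt_of_isOpen hX h.isOpen hy
  have e : ∀ v w, fderiv ℝ B y (X y) v w + B y (fderiv ℝ X y v) w + B y v (fderiv ℝ X y w)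
      = B y w (covDeriv (conn (formMatrix B)) X y v)
        + B y v (covDeriv (conn (formMatrix B)) X y w) := by
    intro v w
    rw [h.metric_compat hy, h.symm y hy w, covDeriv, covDeriv, h.conn_symm hy (X y) v,
      h.conn_symm hy (X y) w]
    simp only [map_add, add_apply]
    ring
  simp only [h.nablaDown_eq hy hX0, e]
  refine ⟨fun H μ ν => H _ _, fun H v w => ?_⟩
  refine isLinearMap_ext_basis (f := fun v => B y w (covDeriv (conn (formMatrix B)) X y v)
        + B y v (covDeriv (conn (formMatrix B)) X y w)) (f' := fun v => c * B y v w)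
    ⟨fun a b => by simp [covDeriv]; ring, fun a b => by simp [covDeriv]; ring⟩
    ⟨fun a b => by simp; ring, fun a b => by simp; ring⟩ (fun μ => ?_) v
  exact isLinearMap_ext_basis
    (f := fun w => B y w (covDeriv (conn (formMatrix B)) X y (basisVec μ))
        + B y (basisVec μ) (covDeriv (conn (formMatrix B)) X y w))
    (f' := fun w => c * B y (basisVec μ) w)
    ⟨fun a b => by simp [covDeriv]; ring, fun a b => by simp [covDeriv]; ring⟩
    ⟨fun a b => by simp; ring, fun a b => by simp; ring⟩ (fun ν => H μ ν) w

theorem isLinearMap_nablaCurv (h : IsLeviCivita U B (conn (formMatrix B)))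
    (hy : y ∈ U) (r a b u v : Coord n) :
    IsLinearMap ℝ (fun r => nablaCurv B (conn (formMatrix B)) y r a b u v) ∧
    IsLinearMap ℝ (fun a => nablaCurv B (conn (formMatrix B)) y r a b u v) ∧
    IsLinearMap ℝ (fun b => nablaCurv B (conn (formMatrix B)) y r a b u v) ∧
    IsLinearMap ℝ (fun u => nablaCurv B (conn (formMatrix B)) y r a b u v) ∧
    IsLinearMap ℝ (fun v => nablaCurv B (conn (formMatrix B)) y r a b u v) := by
  -- Linearity in the four curvature slots is hidden under the derivative, and becomes visible once
  -- the derivative is computed.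
  simp only [nablaCurv, fderiv_curvDown h.isOpen h.smooth_metric h.smooth_conn hy]
  refine ⟨⟨fun _ _ => ?_, fun _ _ => ?_⟩, ⟨fun _ _ => ?_, fun _ _ => ?_⟩,
    ⟨fun _ _ => ?_, fun _ _ => ?_⟩, ⟨fun _ _ => ?_, fun _ _ => ?_⟩,
    ⟨fun _ _ => ?_, fun _ _ => ?_⟩⟩ <;>
  · simp only [curvDown, curv, curvDeriv, map_add, map_sub, map_smul, add_apply, smul_apply,
      smul_eq_mul]
    ring

theorem nablaRiemann_eq (h : IsLeviCivita U B (conn (formMatrix B)))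
    (hy : y ∈ U) (ρ σ μ κ ν : Fin n) :
    nablaRiemann (formMatrix B) ρ σ μ κ ν y
      = nablaCurv B (conn (formMatrix B)) y (basisVec ρ) (basisVec σ) (basisVec μ)
        (basisVec κ) (basisVec ν) := by
  have e : pd ρ (riemann (formMatrix B) σ μ κ ν) y
      = fderiv ℝ (fun z => curvDown B (conn (formMatrix B)) z (basisVec σ) (basisVec μ)
        (basisVec κ) (basisVec ν)) y (basisVec ρ) := by
    have : riemann (formMatrix B) σ μ κ ν =ᶠ[𝓝 y] fun z => curvDown B (conn (formMatrix B)) z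
        (basisVec σ) (basisVec μ) (basisVec κ) (basisVec ν) := by
      filter_upwards [h.isOpen.mem_nhds hy] with z hz using h.riemann_eq hz σ μ κ ν
    rw [pd, this.fderiv_eq]
  have l := isLinearMap_curvDown (B := B) (conn (formMatrix B)) y
  rw [nablaRiemann, e, nablaCurv, isLinearMap_sum_basis (l (basisVec σ) _ _ _).1,
    isLinearMap_sum_basis (l _ (basisVec μ) _ _).2.1,
    isLinearMap_sum_basis (l _ _ (basisVec κ) _).2.2.1,
    isLinearMap_sum_basis (l _ _ _ (basisVec ν)).2.2.2]
  simp only [conn_basisVec, h.riemann_eq hy, Finset.sum_add_distrib, smul_eq_mul]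

theorem thirdDerivExpr_eq (h : IsLeviCivita U B (conn (formMatrix B)))
    (hy : y ∈ U) (hX : DifferentiableAt ℝ X y)
    (hY : DifferentiableAt ℝ Y y) (p : Coord n) :
    thirdDerivExpr (formMatrix B) (comps X) (comps Y) p y
      = -2 * (2 * curvDown B (conn (formMatrix B)) y (covDeriv (conn (formMatrix B)) Y y p) p
          (X y) p
        + 2 * curvDown B (conn (formMatrix B)) y (covDeriv (conn (formMatrix B)) X y p) p (Y y) p
        + nablaCurv B (conn (formMatrix B)) y p (X y) p (Y y) p) := by
  have l := isLinearMap_curvDown (B := B) (conn (formMatrix B)) y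
  have l' := h.isLinearMap_nablaCurv hy
  have e : ∀ (Z : Coord n → Coord n) (u : Coord n), DifferentiableAt ℝ Z y →
      curvDown B (conn (formMatrix B)) y (covDeriv (conn (formMatrix B)) Z y p) p u p
        = ∑ μ, ∑ ν, ∑ ρ, ∑ σ, ∑ κ, p μ * p ν * p ρ *
          (nablaUp (formMatrix B) (comps Z) ρ σ y * riemann (formMatrix B) σ μ κ ν y * u κ) := by
    intro Z u hZ
    have l1 : ∀ b v, IsLinearMap ℝ fun r =>
        curvDown B (conn (formMatrix B)) y (covDeriv (conn (formMatrix B)) Z y r) b u v := by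
      intro b v
      constructor <;> intros <;>
      · simp only [covDeriv, curvDown, curv, map_add, map_sub, map_smul, add_apply, smul_apply,
          smul_eq_mul]
        ring
    rw [isLinearMap_sum_basis (l _ p _ _).2.1]
    refine Finset.sum_congr rfl fun μ _ => ?_
    rw [isLinearMap_sum_basis (l _ _ _ p).2.2.2, Finset.smul_sum]
    refine Finset.sum_congr rfl fun ν _ => ?_
    rw [isLinearMap_sum_basis (l1 _ _), Finset.smul_sum, Finset.smul_sum]
    refine Finset.sum_congr rfl fun ρ _ => ?_
    rw [isLinearMap_sum_basis (l 0 _ _ _).1, Finset.smul_sum, Finset.smul_sum, Finset.smul_sum]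
    refine Finset.sum_congr rfl fun σ _ => ?_
    rw [isLinearMap_sum_basis (l _ _ u _).2.2.1, Finset.smul_sum, Finset.smul_sum,
      Finset.smul_sum, Finset.smul_sum]
    refine Finset.sum_congr rfl fun κ _ => ?_
    rw [h.riemann_eq hy, nablaUp_eq hZ]
    simp only [smul_eq_mul]
    ring
  have e' : nablaCurv B (conn (formMatrix B)) y p (X y) p (Y y) p
      = ∑ μ, ∑ ν, ∑ ρ, ∑ σ, ∑ κ, p μ * p ν * p ρ *
          (X y σ * Y y κ * nablaRiemann (formMatrix B) ρ σ μ κ ν y) := by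
    rw [isLinearMap_sum_basis (l' _ _ p _ _).2.2.1]
    refine Finset.sum_congr rfl fun μ _ => ?_
    rw [isLinearMap_sum_basis (l' _ _ _ _ p).2.2.2.2, Finset.smul_sum]
    refine Finset.sum_congr rfl fun ν _ => ?_
    rw [isLinearMap_sum_basis (l' p _ _ _ _).1, Finset.smul_sum, Finset.smul_sum]
    refine Finset.sum_congr rfl fun ρ _ => ?_
    rw [isLinearMap_sum_basis (l' _ (X y) _ _ _).2.1, Finset.smul_sum, Finset.smul_sum,
      Finset.smul_sum]
    refine Finset.sum_congr rfl fun σ _ => ?_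
    rw [isLinearMap_sum_basis (l' _ _ _ (Y y) _).2.2.2.1, Finset.smul_sum, Finset.smul_sum,
      Finset.smul_sum, Finset.smul_sum]
    refine Finset.sum_congr rfl fun κ _ => ?_
    rw [h.nablaRiemann_eq hy]
    simp only [smul_eq_mul]
    ring
  rw [thirdDerivExpr, e Y (X y) hY, e X (Y y) hX, e']
  simp only [Finset.mul_sum, ← Finset.sum_add_distrib]
  refine Finset.sum_congr rfl fun μ _ => Finset.sum_congr rfl fun ν _ =>
    Finset.sum_congr rfl fun ρ _ => Finset.sum_congr rfl fun σ _ =>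
    Finset.sum_congr rfl fun κ _ => ?_
  ring

end IsLeviCivita

end Dictionary

/-! ### Metric, vector fields and Lie brackets read in a chart -/

section Charts

theorem mlieBracket_eq_lieBracket {E : Type*} [NormedAddCommGroup E] [NormedSpace ℝ E]
    (V W : ∀ x : E, TangentSpace 𝓘(ℝ, E) x) :
    VectorField.mlieBracket 𝓘(ℝ, E) V W = VectorField.lieBracket ℝ V W := by
  rw [← VectorField.mlieBracketWithin_univ, VectorField.mlieBracketWithin_eq_lieBracketWithin]
  exact VectorField.lieBracketWithin_univ

variable {n : ℕ} {M : Type*} [TopologicalSpace M] [ChartedSpace (Coord n) M]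
  {φ : OpenPartialHomeomorph M (Coord n)}

/-- A vector field read in a chart. -/
def chartField (φ : OpenPartialHomeomorph M (Coord n)) (ξ : ∀ x : M, TangentSpace (𝓡 n) x)
    (y : Coord n) : Coord n :=
  mfderiv (𝓡 n) (𝓡 n) φ (φ.symm y) (ξ (φ.symm y))

theorem vecComp_eq (φ : OpenPartialHomeomorph M (Coord n))
    (ξ : ∀ x : M, TangentSpace (𝓡 n) x) : vecComp φ ξ = comps (chartField φ ξ) :=
  rfl

theorem mdifferentiable_of_mem_charts (hφ : φ ∈ charts n M) : φ.MDifferentiable (𝓡 n) (𝓡 n) :=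
  ⟨(contMDiffOn_of_mem_maximalAtlas hφ).mdifferentiableOn (by simp),
    (contMDiffOn_symm_of_mem_maximalAtlas hφ).mdifferentiableOn (by simp)⟩

theorem mfderiv_chart_mfderiv_symm (hφ : φ ∈ charts n M) {y : Coord n} (hy : y ∈ φ.target)
    (v : Coord n) :
    mfderiv (𝓡 n) (𝓡 n) φ (φ.symm y) (mfderiv (𝓡 n) (𝓡 n) φ.symm y v) = v :=
  congrArg (fun L : Coord n →L[ℝ] Coord n => L v)
    ((mdifferentiable_of_mem_charts hφ).comp_symm_deriv hy)

theorem mfderiv_symm_mfderiv_chart (hφ : φ ∈ charts n M) {y : Coord n} (hy : y ∈ φ.target)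
    (v : TangentSpace (𝓡 n) (φ.symm y)) :
    mfderiv (𝓡 n) (𝓡 n) φ.symm y (mfderiv (𝓡 n) (𝓡 n) φ (φ.symm y) v) = v := by
  have := (mdifferentiable_of_mem_charts hφ).symm_comp_deriv (φ.map_target hy)
  rw [φ.right_inv hy] at this
  exact congrArg (fun L : Coord n →L[ℝ] Coord n => L v) this

theorem mfderiv_symm_chartField (hφ : φ ∈ charts n M) {y : Coord n} (hy : y ∈ φ.target)
    (ξ : ∀ x : M, TangentSpace (𝓡 n) x) :
    mfderiv (𝓡 n) (𝓡 n) φ.symm y (chartField φ ξ y) = ξ (φ.symm y) :=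
  mfderiv_symm_mfderiv_chart hφ hy _

variable [IsManifold (𝓡 n) ∞ M] {g : PseudoMetric n M}

/-- The metric read in a chart. -/
def chartForm (g : PseudoMetric n M) (φ : OpenPartialHomeomorph M (Coord n)) (y : Coord n) :
    Coord n →L[ℝ] Coord n →L[ℝ] ℝ :=
  ContinuousLinearMap.bilinearComp (E := Coord n) (F := Coord n) (g.form (φ.symm y))
    (mfderiv (𝓡 n) (𝓡 n) φ.symm y) (mfderiv (𝓡 n) (𝓡 n) φ.symm y)

theorem chartForm_apply (g : PseudoMetric n M) (φ : OpenPartialHomeomorph M (Coord n))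
    (y v w : Coord n) : chartForm g φ y v w = g.form (φ.symm y)
      (mfderiv (𝓡 n) (𝓡 n) φ.symm y v) (mfderiv (𝓡 n) (𝓡 n) φ.symm y w) :=
  rfl

theorem metricComp_eq (g : PseudoMetric n M) (φ : OpenPartialHomeomorph M (Coord n)) :
    metricComp g φ = formMatrix (chartForm g φ) :=
  rfl

theorem scalarProduct_symm (hφ : φ ∈ charts n M) {y : Coord n} (hy : y ∈ φ.target)
    (ξ η : ∀ x : M, TangentSpace (𝓡 n) x) :
    scalarProduct g ξ η (φ.symm y) = chartForm g φ y (chartField φ ξ y) (chartField φ η y) := by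
  rw [chartForm_apply, mfderiv_symm_chartField hφ hy, mfderiv_symm_chartField hφ hy]
  rfl

/-- The chart field is the fibre component of the tangent map of φ composed with the smooth section
ξ. -/
theorem contDiffOn_chartField (hφ : φ ∈ charts n M) {ξ : ∀ x : M, TangentSpace (𝓡 n) x}
    (hξ : ContMDiff (𝓡 n) (𝓡 n).tangent ∞ (fun x => (⟨x, ξ x⟩ : TangentBundle (𝓡 n) M))) :
    ContDiffOn ℝ ∞ (chartField φ ξ) φ.target := by
  rw [← contMDiffOn_iff_contDiffOn]
  have h1 := (contMDiffOn_of_mem_maximalAtlas hφ).contMDiffOn_tangentMapWithin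
    (m := ∞) (by simp) φ.open_source.uniqueMDiffOn
  have h2 := hξ.comp_contMDiffOn (contMDiffOn_symm_of_mem_maximalAtlas hφ)
  have h3 := (contMDiff_snd_tangentBundle_modelSpace (Coord n) (𝓡 n)
    (n := ∞)).comp_contMDiffOn (h1.comp h2 fun y hy => φ.map_target hy)
  refine h3.congr fun y hy => ?_
  simp only [Function.comp, tangentMapWithin]
  rw [mfderivWithin_of_isOpen φ.open_source (φ.map_target hy)]
  rfl

theorem contMDiffOn_mfderiv_symm (hφ : φ ∈ charts n M) (v : Coord n) :
    ContMDiffOn (𝓡 n) (𝓡 n).tangent ∞ (fun y => Bundle.TotalSpace.mk' (Coord n)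
      (E := fun x : M => TangentSpace (𝓡 n) x) (φ.symm y)
      (mfderiv (𝓡 n) (𝓡 n) φ.symm y v)) φ.target := by
  have h1 := (contMDiffOn_symm_of_mem_maximalAtlas hφ).contMDiffOn_tangentMapWithin
    (m := ∞) (by simp) φ.open_target.uniqueMDiffOn
  have h2 : ContMDiff (𝓡 n) (𝓡 n).tangent ∞ (fun y : Coord n =>
      (⟨y, v⟩ : TangentBundle (𝓡 n) (Coord n))) :=
    (contMDiff_vectorSpace_iff_contDiff (E := Coord n) (V := fun _ => v)).2 contDiff_const
  refine (h1.comp h2.contMDiffOn fun y hy => hy).congr fun y hy => ?_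
  simp only [Function.comp, tangentMapWithin]
  rw [mfderivWithin_of_isOpen φ.open_target hy]

/-- In finite dimension it suffices to evaluate on constant vectors v and w, which φ⁻¹ pushes
forward to smooth fields. -/
theorem contDiffOn_chartForm (g : PseudoMetric n M) (hφ : φ ∈ charts n M) :
    ContDiffOn ℝ ∞ (chartForm g φ) φ.target := by
  refine contDiffOn_clm_apply.2 fun v => contDiffOn_clm_apply.2 fun w => ?_
  rw [← contMDiffOn_iff_contDiffOn]
  intro y hy
  have hg := g.smooth.contMDiffAt.comp_contMDiffWithinAt y
    (contMDiffOn_symm_of_mem_maximalAtlas hφ y hy)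
  have h1 : ContMDiffWithinAt (𝓡 n) ((𝓡 n).prod 𝓘(ℝ)) ∞ (fun y =>
      Bundle.TotalSpace.mk' ℝ (E := Bundle.Trivial M ℝ) (φ.symm y) (g.form (φ.symm y)
        (mfderiv (𝓡 n) (𝓡 n) φ.symm y v) (mfderiv (𝓡 n) (𝓡 n) φ.symm y w))) φ.target y := by
    apply ContMDiffWithinAt.clm_bundle_apply₂ (F₁ := Coord n) (F₂ := Coord n)
    · exact hg
    · exact contMDiffOn_mfderiv_symm hφ v y hy
    · exact contMDiffOn_mfderiv_symm hφ w y hy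
  simp only [Bundle.contMDiffWithinAt_totalSpace] at h1
  exact h1.2

theorem chartForm_symm (g : PseudoMetric n M) (φ : OpenPartialHomeomorph M (Coord n))
    (y v w : Coord n) : chartForm g φ y v w = chartForm g φ y w v :=
  g.symm _ _ _

theorem chartForm_nondegenerate (g : PseudoMetric n M) (hφ : φ ∈ charts n M) {y : Coord n}
    (hy : y ∈ φ.target) (v : Coord n) (hv : ∀ w, chartForm g φ y v w = 0) : v = 0 := by
  rw [← mfderiv_chart_mfderiv_symm hφ hy v]
  refine (congrArg _ (g.nondegenerate (φ.symm y) (mfderiv (𝓡 n) (𝓡 n) φ.symm y v)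
    fun w => ?_)).trans (map_zero _)
  rw [← mfderiv_symm_mfderiv_chart hφ hy w]
  exact hv _

/-- The Levi-Civita connection read in a chart. -/
abbrev chartConn (g : PseudoMetric n M) (φ : OpenPartialHomeomorph M (Coord n)) :
    Coord n → Coord n →L[ℝ] Coord n →L[ℝ] Coord n :=
  conn (formMatrix (chartForm g φ))

theorem isLeviCivita_chart (g : PseudoMetric n M) (hφ : φ ∈ charts n M) :
    IsLeviCivita φ.target (chartForm g φ) (chartConn g φ) :=
  isLeviCivita_conn φ.open_target (contDiffOn_chartForm g hφ)
    (fun y _ => chartForm_symm g φ y) fun _ hy => chartForm_nondegenerate g hφ hy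

theorem IsHomothetic.contDiffOn_chartField {ξ : ∀ x : M, TangentSpace (𝓡 n) x} {c : ℝ}
    (h : IsHomothetic g ξ c) (hφ : φ ∈ charts n M) :
    ContDiffOn ℝ ∞ (chartField φ ξ) φ.target :=
  FieldSpace.contDiffOn_chartField hφ h.smooth

theorem IsHomothetic.isHomotheticOn {ξ : ∀ x : M, TangentSpace (𝓡 n) x} {c : ℝ}
    (h : IsHomothetic g ξ c) (hφ : φ ∈ charts n M) :
    IsHomotheticOn φ.target (chartForm g φ) (chartField φ ξ) c :=
  ((isLeviCivita_chart g hφ).isHomotheticOn_iff (h.contDiffOn_chartField hφ)).2 (h.eqn φ hφ)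

/-- The Lie bracket is natural under pullback by φ⁻¹, and the chart field is this pullback. -/
theorem chartField_mlieBracket (hφ : φ ∈ charts n M) {ξ η : ∀ x : M, TangentSpace (𝓡 n) x}
    (hξ : ContMDiff (𝓡 n) (𝓡 n).tangent ∞ (fun x => (⟨x, ξ x⟩ : TangentBundle (𝓡 n) M)))
    (hη : ContMDiff (𝓡 n) (𝓡 n).tangent ∞ (fun x => (⟨x, η x⟩ : TangentBundle (𝓡 n) M)))
    {y : Coord n} (hy : y ∈ φ.target) :
    chartField φ (VectorField.mlieBracket (𝓡 n) ξ η) y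
      = VectorField.lieBracket ℝ (chartField φ ξ) (chartField φ η) y := by
  have hp : ∀ ζ : (∀ x : M, TangentSpace (𝓡 n) x), ∀ z ∈ φ.target,
      VectorField.mpullback (𝓡 n) (𝓡 n) φ.symm ζ z = chartField φ ζ z := by
    intro ζ z hz
    -- Pullback applies the inverse of d(φ⁻¹), which is dφ.
    let e : Coord n ≃L[ℝ] Coord n := ContinuousLinearEquiv.equivOfInverse
      (mfderiv (𝓡 n) (𝓡 n) φ.symm z) (mfderiv (𝓡 n) (𝓡 n) φ (φ.symm z))
      (mfderiv_chart_mfderiv_symm hφ hz) (mfderiv_symm_mfderiv_chart hφ hz)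
    have := ContinuousLinearMap.inverse_equiv e
    exact congrArg (fun L : Coord n →L[ℝ] Coord n => L (ζ (φ.symm z))) this
  have he : ∀ ζ : (∀ x : M, TangentSpace (𝓡 n) x),
      VectorField.mpullback (𝓡 n) (𝓡 n) φ.symm ζ =ᶠ[𝓝 y] chartField φ ζ := fun ζ =>
    Filter.eventuallyEq_of_mem (φ.open_target.mem_nhds hy) (hp ζ)
  have : IsManifold (𝓡 n) (minSmoothness ℝ 2) M := by
    rw [minSmoothness_of_isRCLikeNormedField]
    infer_instance
  rw [← hp _ y hy, VectorField.mpullback_mlieBracket (n := ∞)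
    (hξ.mdifferentiable (by simp) _) (hη.mdifferentiable (by simp) _)
    (contMDiffAt_symm_of_mem_maximalAtlas hφ hy)
    (by rw [minSmoothness_of_isRCLikeNormedField]; exact ENat.LEInfty.out)]
  refine ((he ξ).mlieBracket_vectorField_eq (he η)).trans ?_
  exact congrFun (mlieBracket_eq_lieBracket _ _) y

/-- This is what makes a family spanning all homothetic fields closed under the Lie bracket. -/
theorem IsHomothetic.mlieBracket {ξ η : ∀ x : M, TangentSpace (𝓡 n) x} {c c' : ℝ}
    (hξ : IsHomothetic g ξ c) (hη : IsHomothetic g η c') :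
    IsHomothetic g (VectorField.mlieBracket (𝓡 n) ξ η) 0 := by
  have : IsManifold (𝓡 n) (minSmoothness ℝ 2) M := by
    rw [minSmoothness_of_isRCLikeNormedField]
    infer_instance
  have : IsManifold (𝓡 n) (((⊤ : ℕ∞) : ℕ∞ω) + 1) M := inferInstanceAs (IsManifold (𝓡 n) ∞ M)
  have hs : ContMDiff (𝓡 n) (𝓡 n).tangent ∞ (fun x => (⟨x, VectorField.mlieBracket (𝓡 n) ξ η x⟩ :
      TangentBundle (𝓡 n) M)) := fun x =>
    ContMDiffAt.mlieBracket_vectorField (n := ⊤) (m := ⊤) (hξ.smooth x) (hη.smooth x)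
      (by rw [minSmoothness_of_isRCLikeNormedField]; rfl)
  refine ⟨hs, fun φ hφ => ?_⟩
  have hc := FieldSpace.contDiffOn_chartField hφ hs
  refine ((isLeviCivita_chart g hφ).isHomotheticOn_iff hc).1 fun y hy v w => ?_
  have he : chartField φ (VectorField.mlieBracket (𝓡 n) ξ η) =ᶠ[𝓝 y]
      VectorField.lieBracket ℝ (chartField φ ξ) (chartField φ η) :=
    Filter.eventuallyEq_of_mem (φ.open_target.mem_nhds hy)
      fun z hz => chartField_mlieBracket hφ hξ.smooth hη.smooth hz
  rw [he.fderiv_eq, he.eq_of_nhds]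
  exact (hξ.isHomotheticOn hφ).lieBracket (hη.isHomotheticOn hφ) φ.open_target
    (contDiffOn_chartForm g hφ) (hξ.contDiffOn_chartField hφ) (hη.contDiffOn_chartField hφ) y hy v w

end Charts

/-! ### The third derivative of V along geodesics of the manifold -/

section Geodesics

variable {n : ℕ} {M : Type*} [TopologicalSpace M] [ChartedSpace (Coord n) M]
  [IsManifold (𝓡 n) ∞ M] {g : PseudoMetric n M} {φ : OpenPartialHomeomorph M (Coord n)}
  {γ : ℝ → M} {J : Set ℝ}

theorem deriv_coord {q : ℝ → Coord n} {t : ℝ} (hq : DifferentiableAt ℝ q t) (μ : Fin n) :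
    deriv (fun s => q s μ) t = deriv q t μ :=
  ((EuclideanSpace.proj μ : Coord n →L[ℝ] ℝ).hasFDerivAt.comp_hasDerivAt t hq.hasDerivAt).deriv

/-- A geodesic read in a chart. -/
theorem IsGeodesicOn.exists_chart (h : IsGeodesicOn g γ J) (hJ : IsOpen J) (hφ : φ ∈ charts n M)
    {t : ℝ} (ht : t ∈ J) (hγ : γ t ∈ φ.source) :
    ∃ N : Set ℝ, IsOpen N ∧ t ∈ N ∧ N ⊆ J ∧ (∀ s ∈ N, γ s ∈ φ.source) ∧
      ContDiffOn ℝ ∞ (fun s => φ (γ s)) N ∧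
      (∀ s ∈ N, HasDerivAt (fun s => φ (γ s)) (deriv (fun s => φ (γ s)) s) s) ∧
      (∀ s ∈ N, HasDerivAt (deriv fun s => φ (γ s))
        (-chartConn g φ (φ (γ s)) (deriv (fun s => φ (γ s)) s) (deriv (fun s => φ (γ s)) s)) s) ∧
      ∀ s ∈ N, velocity φ γ s = deriv (fun s => φ (γ s)) s := by
  have hN : IsOpen (J ∩ γ ⁻¹' φ.source) :=
    h.smooth.continuousOn.isOpen_inter_preimage hJ φ.open_source
  have hq : ContDiffOn ℝ ∞ (fun s => φ (γ s)) (J ∩ γ ⁻¹' φ.source) := by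
    rw [← contMDiffOn_iff_contDiffOn]
    exact (contMDiffOn_of_mem_maximalAtlas hφ).comp (h.smooth.mono Set.inter_subset_left)
      fun s hs => hs.2
  have hd : ∀ s ∈ J ∩ γ ⁻¹' φ.source, DifferentiableAt ℝ (fun s => φ (γ s)) s := fun s hs =>
    ContDiffOn.differentiableAt_of_isOpen hq hN hs
  have hd' : ContDiffOn ℝ ∞ (deriv fun s => φ (γ s)) (J ∩ γ ⁻¹' φ.source) :=
    hq.deriv_of_isOpen hN (by simp)
  have hv : ∀ s ∈ J ∩ γ ⁻¹' φ.source, velocity φ γ s = deriv (fun s => φ (γ s)) s :=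
    fun s hs => funext fun μ => deriv_coord (hd s hs) μ
  refine ⟨_, hN, ⟨ht, hγ⟩, Set.inter_subset_left, fun s hs => hs.2, hq,
    fun s hs => (hd s hs).hasDerivAt, fun s hs => ?_, hv⟩
  have hds := ContDiffOn.differentiableAt_of_isOpen hd' hN hs
  refine hds.hasDerivAt.congr_deriv ?_
  ext μ
  have e := h.eqn φ hφ s hs.1 hs.2 μ
  have e2 : iteratedDeriv 2 (fun s => φ (γ s) μ) s = deriv (deriv fun s => φ (γ s)) s μ := by
    rw [iteratedDeriv_succ, iteratedDeriv_one, ← deriv_coord hds]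
    exact Filter.EventuallyEq.deriv_eq (Filter.eventuallyEq_of_mem (hN.mem_nhds hs)
      fun r hr => deriv_coord (hd r hr) μ)
  rw [e2, hv s hs] at e
  rw [PiLp.neg_apply, conn_apply, ← metricComp_eq]
  simp only [← mul_assoc]
  linarith

theorem IsGeodesicOn.contDiffAt_scalarProduct (h : IsGeodesicOn g γ J) (hJ : IsOpen J)
    {ξ η : ∀ x : M, TangentSpace (𝓡 n) x} {c c' : ℝ} (hξ : IsHomothetic g ξ c)
    (hη : IsHomothetic g η c') {t : ℝ} (ht : t ∈ J) :
    ContDiffAt ℝ ∞ (fun s => scalarProduct g ξ η (γ s)) t := by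
  have hφ : chartAt (Coord n) (γ t) ∈ charts n M := IsManifold.chart_mem_maximalAtlas _
  obtain ⟨N, hN, htN, -, hs, hq, -⟩ := h.exists_chart hJ hφ ht (mem_chart_source _ _)
  set φ := chartAt (Coord n) (γ t)
  have hm : Set.MapsTo (fun s => φ (γ s)) N φ.target := fun s hsN => φ.map_source (hs s hsN)
  have hc := (((contDiffOn_chartForm g hφ).comp hq hm).clm_apply
    ((hξ.contDiffOn_chartField hφ).comp hq hm)).clm_apply
    ((hη.contDiffOn_chartField hφ).comp hq hm)
  refine (hc.contDiffAt (hN.mem_nhds htN)).congr_of_eventuallyEq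
    (Filter.eventuallyEq_of_mem (hN.mem_nhds htN) fun s hsN => ?_)
  have := scalarProduct_symm (g := g) hφ (hm hsN) ξ η
  rw [φ.left_inv (hs s hsN)] at this
  exact this

theorem IsGeodesicOn.iteratedDeriv_scalarProduct (h : IsGeodesicOn g γ J) (hJ : IsOpen J)
    {ξ η : ∀ x : M, TangentSpace (𝓡 n) x} {c c' : ℝ} (hξ : IsHomothetic g ξ c)
    (hη : IsHomothetic g η c') {t : ℝ} (ht : t ∈ J) (hφ : φ ∈ charts n M)
    (hγ : γ t ∈ φ.source) :
    iteratedDeriv 3 (fun s => scalarProduct g ξ η (γ s)) t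
      = thirdDerivExpr (metricComp g φ) (vecComp φ ξ) (vecComp φ η) (velocity φ γ t)
        (φ (γ t)) := by
  obtain ⟨N, hN, htN, -, hs, -, hq, hp, hv⟩ := h.exists_chart hJ hφ ht hγ
  have hm : Set.MapsTo (fun s => φ (γ s)) N φ.target := fun s hsN => φ.map_source (hs s hsN)
  have hlc := isLeviCivita_chart g hφ
  have e : (fun s => scalarProduct g ξ η (γ s)) =ᶠ[𝓝 t] fun s =>
      chartForm g φ (φ (γ s)) (chartField φ ξ (φ (γ s))) (chartField φ η (φ (γ s))) := by
    refine Filter.eventuallyEq_of_mem (hN.mem_nhds htN) fun s hsN => ?_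
    have := scalarProduct_symm (g := g) hφ (hm hsN) ξ η
    rw [φ.left_inv (hs s hsN)] at this
    exact this
  have hX := hξ.contDiffOn_chartField hφ
  have hY := hη.contDiffOn_chartField hφ
  rw [e.iteratedDeriv_eq, hlc.iteratedDeriv_three_metric hX hY (hξ.isHomotheticOn hφ)
    (hη.isHomotheticOn hφ) hN hm hq hp htN, hv t htN, metricComp_eq, vecComp_eq, vecComp_eq,
    hlc.thirdDerivExpr_eq (hm htN)
      (ContDiffOn.differentiableAt_of_isOpen hX φ.open_target (hm htN))
      (ContDiffOn.differentiableAt_of_isOpen hY φ.open_target (hm htN))]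

/-- Vanishing on an open set, and not only at y, is needed for the partial derivatives inside ∇R to
vanish too. -/
theorem thirdDerivExpr_eq_zero {G : Coord n → Matrix (Fin n) (Fin n) ℝ} {U : Set (Coord n)}
    (hU : IsOpen U) (h : ∀ y ∈ U, ∀ ρ σ μ ν, riemann G ρ σ μ ν y = 0) {y : Coord n} (hy : y ∈ U)
    (X Y : Fin n → Coord n → ℝ) (p : Fin n → ℝ) : thirdDerivExpr G X Y p y = 0 := by
  have hd : ∀ ρ σ μ κ ν, pd ρ (riemann G σ μ κ ν) y = 0 := by
    intro ρ σ μ κ ν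
    have : riemann G σ μ κ ν =ᶠ[𝓝 y] fun _ => 0 :=
      Filter.eventuallyEq_of_mem (hU.mem_nhds hy) fun z hz => h z hz σ μ κ ν
    rw [pd, this.fderiv_eq]
    simp
  simp [thirdDerivExpr, nablaRiemann, h y hy, hd]

end Geodesics

/-! ### Canonical coordinates on phase space and derivatives of the generators -/

section Phase

variable {n : ℕ} {M : Type*} [TopologicalSpace M] [ChartedSpace (Coord n) M]
  {φ : OpenPartialHomeomorph M (Coord n)}

theorem sum_pd_mul (f : Coord n → ℝ) (y v : Coord n) : ∑ μ, pd μ f y * v μ = fderiv ℝ f y v := by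
  rw [← sum_apply_basisVec]
  exact Finset.sum_congr rfl fun μ _ => mul_comm _ _

/-- The Euclidean inner product serves only as the pairing of momentum coordinates with coordinate
vectors. It is unrelated to g. -/
theorem inner_basisVec (a : Coord n) (μ : Fin n) : inner ℝ a (basisVec μ) = a μ := by
  simp [basisVec, EuclideanSpace.inner_single_right]

theorem inner_eq_sum (a v : Coord n) : inner ℝ a v = ∑ μ, a μ * v μ := by
  rw [← innerSL_apply_apply ℝ, ← sum_apply_basisVec (innerSL ℝ a)]
  simp only [innerSL_apply_apply, inner_basisVec, smul_eq_mul]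
  exact Finset.sum_congr rfl fun μ _ => mul_comm _ _

theorem sum_smul_coordForm_apply (φ : OpenPartialHomeomorph M (Coord n)) (a : Coord n) (x : M)
    (w : TangentSpace (𝓡 n) x) :
    (∑ μ, a μ • coordForm φ μ x) w = inner ℝ a (mfderiv (𝓡 n) (𝓡 n) φ x w : Coord n) := by
  refine Eq.trans ?_ (inner_eq_sum a _).symm
  rw [FunLike.coe_sum, Finset.sum_apply]
  rfl

/-- The Poisson bracket computed in a chart. -/
def coordPoisson (φ : OpenPartialHomeomorph M (Coord n)) (F K : PhaseFun n M) (y a : Coord n) :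
    ℝ :=
  ∑ μ, (pd μ (fun z => inCoords φ F z a) y * pd μ (fun b => inCoords φ K y b) a
    - pd μ (fun b => inCoords φ F y b) a * pd μ (fun z => inCoords φ K z a) y)

/-- The momentum coordinates of `p` in the chart `φ`. -/
def momentumCoords (φ : OpenPartialHomeomorph M (Coord n)) (x : M)
    (p : TangentSpace (𝓡 n) x →L[ℝ] ℝ) : Coord n :=
  WithLp.toLp 2 fun μ => p (mfderiv (𝓡 n) (𝓡 n) φ.symm (φ x)
    (EuclideanSpace.single μ (1 : ℝ) : Coord n))

theorem poisson_eq (F K : PhaseFun n M) (x : M) (p : TangentSpace (𝓡 n) x →L[ℝ] ℝ) :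
    poisson F K x p = coordPoisson (chartAt (Coord n) x) F K (chartAt (Coord n) x x)
      (momentumCoords (chartAt (Coord n) x) x p) :=
  rfl

theorem inCoords_momentumCoords (hφ : φ ∈ charts n M) {x : M} (hx : x ∈ φ.source)
    (F : PhaseFun n M) (p : TangentSpace (𝓡 n) x →L[ℝ] ℝ) :
    inCoords φ F (φ x) (momentumCoords φ x p) = F x p := by
  have hp : ∑ μ, momentumCoords φ x p μ • coordForm φ μ x = p := by
    ext w
    have h1 := (mdifferentiable_of_mem_charts hφ).symm_comp_deriv hx
    have h2 : mfderiv (𝓡 n) (𝓡 n) φ.symm (φ x) (mfderiv (𝓡 n) (𝓡 n) φ x w) = w :=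
      congrArg (fun L : Coord n →L[ℝ] Coord n => L w) h1
    rw [sum_smul_coordForm_apply]
    refine (inner_eq_sum _ _).trans ?_
    let L : Coord n →L[ℝ] ℝ := ContinuousLinearMap.comp (M₁ := Coord n) (M₂ := Coord n) p
      (mfderiv (𝓡 n) (𝓡 n) φ.symm (φ x))
    have h3 := sum_apply_basisVec L (mfderiv (𝓡 n) (𝓡 n) φ x w : Coord n)
    refine Eq.trans ?_ (h3.trans (congrArg (fun v : Coord n => p v) h2))
    exact Finset.sum_congr rfl fun μ _ => mul_comm _ _
  -- The type of the momentum depends on the base point, so φ⁻¹(φ x) is generalised before being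
  -- identified with x.
  have key : ∀ x', x' = x → F x' (∑ μ, momentumCoords φ x p μ • coordForm φ μ x') = F x p := by
    rintro x' rfl
    rw [hp]
  exact key _ (φ.left_inv hx)

theorem inCoords_linearCharge (ξ : ∀ x : M, TangentSpace (𝓡 n) x) (y a : Coord n) :
    inCoords φ (linearCharge ξ) y a = inner ℝ a (chartField φ ξ y) := by
  rw [inCoords, linearCharge, sum_smul_coordForm_apply]
  rfl

theorem fderiv_linearCharge_position {ξ : ∀ x : M, TangentSpace (𝓡 n) x} {y : Coord n}
    (hξ : DifferentiableAt ℝ (chartField φ ξ) y) (a v : Coord n) :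
    DifferentiableAt ℝ (fun z => inCoords φ (linearCharge ξ) z a) y ∧
    fderiv ℝ (fun z => inCoords φ (linearCharge ξ) z a) y v
      = inner ℝ a (fderiv ℝ (chartField φ ξ) y v) := by
  simp only [inCoords_linearCharge]
  refine ⟨(differentiableAt_const a).inner ℝ hξ, ?_⟩
  rw [fderiv_inner_apply ℝ (differentiableAt_const a) hξ]
  simp

theorem fderiv_linearCharge_momentum (ξ : ∀ x : M, TangentSpace (𝓡 n) x) (y a v : Coord n) :
    DifferentiableAt ℝ (fun b => inCoords φ (linearCharge ξ) y b) a ∧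
    fderiv ℝ (fun b => inCoords φ (linearCharge ξ) y b) a v
      = inner ℝ v (chartField φ ξ y) := by
  simp only [inCoords_linearCharge]
  refine ⟨differentiableAt_fun_id.inner ℝ (differentiableAt_const _), ?_⟩
  rw [fderiv_inner_apply ℝ differentiableAt_fun_id (differentiableAt_const _)]
  simp

variable [IsManifold (𝓡 n) ∞ M] {g : PseudoMetric n M}

/-- A bracket formula established in every chart holds in particular in the preferred chart at each
point. Thus invariance of the bracket under changes of chart is never needed. -/
theorem poisson_eq_of_coordPoisson {F K Q : PhaseFun n M}
    (h : ∀ φ ∈ charts n M, ∀ y ∈ φ.target, ∀ a, coordPoisson φ F K y a = inCoords φ Q y a) :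
    poisson F K = Q := by
  funext x p
  have hφ : chartAt (Coord n) x ∈ charts n M := IsManifold.chart_mem_maximalAtlas x
  rw [poisson_eq, h _ hφ _ (mem_chart_target _ x),
    inCoords_momentumCoords hφ (mem_chart_source _ x)]

theorem form_sharp (g : PseudoMetric n M) (x : M) (p : TangentSpace (𝓡 n) x →L[ℝ] ℝ) :
    g.form x (g.sharp x p) = p :=
  (g.exists_sharp x p).choose_spec

theorem form_injective (g : PseudoMetric n M) (x : M) {v w : TangentSpace (𝓡 n) x}
    (h : g.form x v = g.form x w) : v = w := by
  rw [← sub_eq_zero]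
  refine g.nondegenerate x _ fun z => ?_
  rw [map_sub, h, sub_self]
  rfl

theorem sharp_neg (g : PseudoMetric n M) (x : M) (p : TangentSpace (𝓡 n) x →L[ℝ] ℝ) :
    g.sharp x (-p) = -g.sharp x p := by
  refine form_injective g x ?_
  rw [form_sharp, map_neg, form_sharp]

/-! #### The inverse metric in a chart -/

theorem chartForm_isInvertible (g : PseudoMetric n M) (hφ : φ ∈ charts n M) {y : Coord n}
    (hy : y ∈ φ.target) : (chartForm g φ y).IsInvertible := by
  have hinj : Function.Injective (chartForm g φ y).toLinearMap := by
    rw [injective_iff_map_eq_zero]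
    intro v hv
    exact chartForm_nondegenerate g hφ hy v fun w =>
      congrArg (fun f : Coord n →L[ℝ] ℝ => f w) hv
  have hdim : Module.finrank ℝ (Coord n) = Module.finrank ℝ (Coord n →L[ℝ] ℝ) := by
    rw [← (LinearMap.toContinuousLinearMap :
      (Coord n →ₗ[ℝ] ℝ) ≃ₗ[ℝ] (Coord n →L[ℝ] ℝ)).finrank_eq]
    exact (Subspace.dual_finrank_eq (K := ℝ) (V := Coord n)).symm
  exact ⟨(LinearMap.linearEquivOfInjective _ hinj hdim).toContinuousLinearEquiv, rfl⟩

/-- The momentum with coordinates `a` with its index raised, in a chart. -/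
def chartSharp (g : PseudoMetric n M) (φ : OpenPartialHomeomorph M (Coord n)) (y a : Coord n) :
    Coord n :=
  (chartForm g φ y).inverse (innerSL ℝ a)

theorem chartForm_chartSharp (g : PseudoMetric n M) (hφ : φ ∈ charts n M) {y : Coord n}
    (hy : y ∈ φ.target) (a v : Coord n) :
    chartForm g φ y (chartSharp g φ y a) v = inner ℝ a v := by
  obtain ⟨e, he⟩ := chartForm_isInvertible g hφ hy
  rw [chartSharp, ← he, ContinuousLinearMap.inverse_equiv]
  simp

theorem mfderiv_sharp (g : PseudoMetric n M) (hφ : φ ∈ charts n M) {y : Coord n}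
    (hy : y ∈ φ.target) (a : Coord n) :
    mfderiv (𝓡 n) (𝓡 n) φ (φ.symm y)
      (g.sharp (φ.symm y) (∑ μ, a μ • coordForm φ μ (φ.symm y))) = chartSharp g φ y a := by
  refine (isLeviCivita_chart g hφ).ext hy fun v => ?_
  rw [chartForm_chartSharp g hφ hy]
  refine (chartForm_apply g φ y _ v).trans ?_
  rw [mfderiv_symm_mfderiv_chart hφ hy, form_sharp, sum_smul_coordForm_apply,
    mfderiv_chart_mfderiv_symm hφ hy]

theorem inCoords_hamiltonian (g : PseudoMetric n M) (hφ : φ ∈ charts n M) {y : Coord n}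
    (hy : y ∈ φ.target) (a : Coord n) :
    inCoords φ (hamiltonian g) y a = (1 / 2) * inner ℝ a (chartSharp g φ y a) := by
  rw [inCoords, hamiltonian, sum_smul_coordForm_apply, mfderiv_sharp g hφ hy]

theorem differentiableAt_chartSharp (g : PseudoMetric n M) (hφ : φ ∈ charts n M) {y : Coord n}
    (hy : y ∈ φ.target) (a : Coord n) : DifferentiableAt ℝ (fun z => chartSharp g φ z a) y := by
  have h1 := ContDiffOn.differentiableAt_of_isOpen (contDiffOn_chartForm g hφ) φ.open_target hy
  have h2 := ((chartForm_isInvertible g hφ hy).contDiffAt_map_inverse (n := 1)).differentiableAt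
    (by simp)
  exact (h2.comp y h1).clm_apply (differentiableAt_const _)

theorem fderiv_hamiltonian_position (g : PseudoMetric n M) (hφ : φ ∈ charts n M) {y : Coord n}
    (hy : y ∈ φ.target) (a v : Coord n) :
    DifferentiableAt ℝ (fun z => inCoords φ (hamiltonian g) z a) y ∧
    fderiv ℝ (fun z => inCoords φ (hamiltonian g) z a) y v
      = -(1 / 2) * fderiv ℝ (chartForm g φ) y v (chartSharp g φ y a) (chartSharp g φ y a) := by
  have hB := ContDiffOn.differentiableAt_of_isOpen (contDiffOn_chartForm g hφ) φ.open_target hy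
  have hS := differentiableAt_chartSharp g hφ hy a
  have e : (fun z => inCoords φ (hamiltonian g) z a) =ᶠ[𝓝 y]
      fun z => (1 / 2) * inner ℝ a (chartSharp g φ z a) :=
    Filter.eventuallyEq_of_mem (φ.open_target.mem_nhds hy)
      fun z hz => inCoords_hamiltonian g hφ hz a
  have hI : DifferentiableAt ℝ (fun z => inner ℝ a (chartSharp g φ z a)) y :=
    (differentiableAt_const a).inner ℝ hS
  have hI' : fderiv ℝ (fun z => inner ℝ a (chartSharp g φ z a)) y v
      = inner ℝ a (fderiv ℝ (fun z => chartSharp g φ z a) y v) := by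
    rw [fderiv_inner_apply ℝ (differentiableAt_const a) hS]
    simp
  refine ⟨(hI.const_mul (1 / 2)).congr_of_eventuallyEq e, ?_⟩
  -- Differentiating the identity g(a♯, u) = ⟨a, u⟩ with u frozen at the value of a♯ at y yields the
  -- derivative of the inverse metric on (a, a).
  have e' : (fun z => chartForm g φ z (chartSharp g φ z a) (chartSharp g φ y a)) =ᶠ[𝓝 y]
      fun _ => inner ℝ a (chartSharp g φ y a) :=
    Filter.eventuallyEq_of_mem (φ.open_target.mem_nhds hy)
      fun z hz => chartForm_chartSharp g hφ hz a _
  have k := congrArg (fun L : Coord n →L[ℝ] ℝ => L v) e'.fderiv_eq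
  rw [fderiv_apply_two (Y := fun _ => chartSharp g φ y a) hB hS (differentiableAt_const _),
    chartForm_symm g φ y (fderiv ℝ _ y v), chartForm_chartSharp g hφ hy] at k
  rw [e.fderiv_eq, fderiv_const_mul hI, FunLike.coe_smul, Pi.smul_apply, hI', smul_eq_mul]
  simp only [fderiv_fun_const, Pi.zero_apply, zero_apply, map_zero, add_zero] at k
  linear_combination (1 / 2) * k

theorem fderiv_hamiltonian_momentum (g : PseudoMetric n M) (hφ : φ ∈ charts n M) {y : Coord n}
    (hy : y ∈ φ.target) (a v : Coord n) :
    DifferentiableAt ℝ (fun b => inCoords φ (hamiltonian g) y b) a ∧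
    fderiv ℝ (fun b => inCoords φ (hamiltonian g) y b) a v = inner ℝ v (chartSharp g φ y a) := by
  let L : Coord n →L[ℝ] Coord n := (chartForm g φ y).inverse.comp (innerSL ℝ)
  have e : (fun b => inCoords φ (hamiltonian g) y b) = fun b => (1 / 2) * inner ℝ b (L b) :=
    funext fun b => inCoords_hamiltonian g hφ hy b
  have hL : DifferentiableAt ℝ (fun b => L b) a := L.differentiableAt
  have hI : DifferentiableAt ℝ (fun b => inner ℝ b (L b)) a := differentiableAt_id.inner ℝ hL
  rw [e]
  refine ⟨hI.const_mul _, ?_⟩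
  rw [fderiv_const_mul hI, FunLike.coe_smul, Pi.smul_apply,
    fderiv_inner_apply ℝ differentiableAt_fun_id hL, L.fderiv, fderiv_fun_id]
  -- The inverse metric is symmetric because g is.
  have k : inner ℝ a (L v) = inner ℝ v (L a) := by
    rw [← chartForm_chartSharp g hφ hy a, ← chartForm_chartSharp g hφ hy v, chartForm_symm]
    rfl
  rw [k, smul_eq_mul]
  change (1 / 2) * (inner ℝ v (L a) + inner ℝ v (L a)) = inner ℝ v (L a)
  ring

theorem fderiv_scalarProduct_symm {ξ η : ∀ x : M, TangentSpace (𝓡 n) x} {c c' : ℝ}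
    (hξ : IsHomothetic g ξ c) (hη : IsHomothetic g η c') (hφ : φ ∈ charts n M) {y : Coord n}
    (hy : y ∈ φ.target) (v : Coord n) :
    DifferentiableAt ℝ (fun z => scalarProduct g ξ η (φ.symm z)) y ∧
    fderiv ℝ (fun z => scalarProduct g ξ η (φ.symm z)) y v
      = fderiv ℝ (chartForm g φ) y v (chartField φ ξ y) (chartField φ η y)
        + chartForm g φ y (fderiv ℝ (chartField φ ξ) y v) (chartField φ η y)
        + chartForm g φ y (chartField φ ξ y) (fderiv ℝ (chartField φ η) y v) := by
  have hB := ContDiffOn.differentiableAt_of_isOpen (contDiffOn_chartForm g hφ) φ.open_target hy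
  have hX := ContDiffOn.differentiableAt_of_isOpen (hξ.contDiffOn_chartField hφ) φ.open_target hy
  have hY := ContDiffOn.differentiableAt_of_isOpen (hη.contDiffOn_chartField hφ) φ.open_target hy
  have e : (fun z => scalarProduct g ξ η (φ.symm z)) =ᶠ[𝓝 y]
      fun z => chartForm g φ z (chartField φ ξ z) (chartField φ η z) :=
    Filter.eventuallyEq_of_mem (φ.open_target.mem_nhds hy)
      fun z hz => scalarProduct_symm hφ hz ξ η
  refine ⟨((hB.clm_apply hX).clm_apply hY).congr_of_eventuallyEq e, ?_⟩
  rw [e.fderiv_eq, fderiv_apply_two hB hX hY]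

end Phase

/-! ### Poisson brackets of the generators -/

section Brackets

variable {n : ℕ} {M : Type*} [TopologicalSpace M] [ChartedSpace (Coord n) M]
  {φ : OpenPartialHomeomorph M (Coord n)}

/-- The momentum gradient of a generator is a vector: ξ for C, the raised momentum for H, and 0 for
V. The bracket then consists of two position derivatives along such vectors. -/
theorem coordPoisson_eq {F K : PhaseFun n M} {y a X Y : Coord n}
    (hF : ∀ v, fderiv ℝ (fun b => inCoords φ F y b) a v = inner ℝ v X)
    (hK : ∀ v, fderiv ℝ (fun b => inCoords φ K y b) a v = inner ℝ v Y) :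
    coordPoisson φ F K y a = fderiv ℝ (fun z => inCoords φ F z a) y Y
      - fderiv ℝ (fun z => inCoords φ K z a) y X := by
  have e : ∀ (f : Coord n → ℝ) (Z : Coord n), (∀ v, fderiv ℝ f a v = inner ℝ v Z) →
      ∀ μ, pd μ f a = Z μ := fun f Z h μ => by
    rw [pd, h, real_inner_comm, inner_basisVec]
  rw [coordPoisson, Finset.sum_sub_distrib, ← sum_pd_mul, ← sum_pd_mul]
  refine congrArg₂ _ (Finset.sum_congr rfl fun μ _ => ?_) (Finset.sum_congr rfl fun μ _ => ?_)
  · rw [e _ _ hK]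
  · rw [e _ _ hF, mul_comm]

theorem poisson_antisymm (F K : PhaseFun n M) : poisson F K = -poisson K F := by
  funext x p
  rw [Pi.neg_apply, Pi.neg_apply, poisson_eq, poisson_eq, coordPoisson, coordPoisson,
    ← Finset.sum_neg_distrib]
  exact Finset.sum_congr rfl fun μ _ => by ring

theorem poisson_self (F : PhaseFun n M) : poisson F F = 0 := by
  funext x p
  rw [poisson_eq, coordPoisson]
  exact Finset.sum_eq_zero fun μ _ => by ring

theorem fderiv_ofBase_momentum (f : M → ℝ) (y a v : Coord n) :
    fderiv ℝ (fun b => inCoords φ (ofBase f) y b) a v = inner ℝ v (0 : Coord n) := by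
  rw [inner_zero_right]
  exact congrArg (fun L : Coord n →L[ℝ] ℝ => L v) (fderiv_fun_const (f (φ.symm y)) |> congrFun <| a)

theorem mfderiv_mfderiv_symm {f : M → ℝ} (hφ : φ ∈ charts n M) {y : Coord n} (hy : y ∈ φ.target)
    (hf : DifferentiableAt ℝ (fun z => f (φ.symm z)) y) (w : Coord n) :
    mfderiv (𝓡 n) 𝓘(ℝ, ℝ) f (φ.symm y) (mfderiv (𝓡 n) (𝓡 n) φ.symm y w)
      = fderiv ℝ (fun z => f (φ.symm z)) y w := by
  have hx := φ.map_target hy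
  have h1 := (mdifferentiable_of_mem_charts hφ).mdifferentiableAt hx
  have h2 := (mdifferentiable_of_mem_charts hφ).mdifferentiableAt_symm hy
  have e : f =ᶠ[𝓝 (φ.symm y)] (fun z => f (φ.symm z)) ∘ φ :=
    Filter.eventuallyEq_of_mem (φ.open_source.mem_nhds hx)
      fun x hx => congrArg f (φ.left_inv hx).symm
  have hf' : MDifferentiableAt (𝓡 n) 𝓘(ℝ, ℝ) f (φ.symm y) := by
    refine MDifferentiableAt.congr_of_eventuallyEq ?_ e
    refine MDifferentiableAt.comp (I' := 𝓡 n) _ ?_ h1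
    rw [φ.right_inv hy]
    exact hf.mdifferentiableAt
  have := mfderiv_comp (I := 𝓡 n) (I' := 𝓡 n) (I'' := 𝓘(ℝ, ℝ)) y hf' h2
  rw [← mfderiv_eq_fderiv]
  exact (congrArg (fun L : Coord n →L[ℝ] ℝ => L w) this).symm

variable [IsManifold (𝓡 n) ∞ M] {g : PseudoMetric n M}
  {ξ η ζ : ∀ x : M, TangentSpace (𝓡 n) x} {c c' c'' : ℝ}

theorem poisson_ofBase_ofBase (f f' : M → ℝ) :
    poisson (ofBase f) (ofBase f') = (0 : PhaseFun n M) := by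
  refine poisson_eq_of_coordPoisson fun φ hφ y hy a => ?_
  rw [coordPoisson_eq (fderiv_ofBase_momentum _ _ _) (fderiv_ofBase_momentum _ _ _),
    map_zero, map_zero, sub_zero]
  rfl

theorem IsHomothetic.differentiableAt_chartField (h : IsHomothetic g ξ c) (hφ : φ ∈ charts n M)
    {y : Coord n} (hy : y ∈ φ.target) : DifferentiableAt ℝ (chartField φ ξ) y :=
  ContDiffOn.differentiableAt_of_isOpen (h.contDiffOn_chartField hφ) φ.open_target hy

theorem poisson_linearCharge_linearCharge (hξ : IsHomothetic g ξ c) (hη : IsHomothetic g η c') :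
    poisson (linearCharge ξ) (linearCharge η)
      = -linearCharge (VectorField.mlieBracket (𝓡 n) ξ η) := by
  refine poisson_eq_of_coordPoisson fun φ hφ y hy a => ?_
  have e : inCoords φ (-linearCharge (VectorField.mlieBracket (𝓡 n) ξ η)) y a
      = -inner ℝ a (chartField φ (VectorField.mlieBracket (𝓡 n) ξ η) y) :=
    congrArg Neg.neg (inCoords_linearCharge _ y a)
  rw [coordPoisson_eq (fun v => (fderiv_linearCharge_momentum ξ y a v).2)
    (fun v => (fderiv_linearCharge_momentum η y a v).2),
    (fderiv_linearCharge_position (hξ.differentiableAt_chartField hφ hy) a _).2,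
    (fderiv_linearCharge_position (hη.differentiableAt_chartField hφ hy) a _).2, e,
    chartField_mlieBracket hφ hξ.smooth hη.smooth hy, VectorField.lieBracket, inner_sub_right]
  ring

/-- Half of L_ξ g = c g evaluated on the raised momentum. -/
theorem poisson_linearCharge_hamiltonian (hξ : IsHomothetic g ξ c) :
    poisson (linearCharge ξ) (hamiltonian g) = c • hamiltonian g := by
  refine poisson_eq_of_coordPoisson fun φ hφ y hy a => ?_
  have e : inCoords φ (c • hamiltonian g) y a
      = c * ((1 / 2) * inner ℝ a (chartSharp g φ y a)) :=
    congrArg (c * ·) (inCoords_hamiltonian g hφ hy a)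
  have k := hξ.isHomotheticOn hφ y hy (chartSharp g φ y a) (chartSharp g φ y a)
  rw [chartForm_symm g φ y (fderiv ℝ _ y _), chartForm_chartSharp g hφ hy,
    chartForm_chartSharp g hφ hy] at k
  rw [coordPoisson_eq (fun v => (fderiv_linearCharge_momentum ξ y a v).2)
    (fun v => (fderiv_hamiltonian_momentum g hφ hy a v).2),
    (fderiv_linearCharge_position (hξ.differentiableAt_chartField hφ hy) a _).2,
    (fderiv_hamiltonian_position g hφ hy a _).2, e]
  linear_combination (1 / 2) * k

/-- The bracket is -ξ(g(η, ζ)), expanded by the Leibniz rule for L_ξ with L_ξ g = c g. -/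
theorem poisson_linearCharge_scalarProduct (hξ : IsHomothetic g ξ c) (hη : IsHomothetic g η c')
    (hζ : IsHomothetic g ζ c'') :
    poisson (linearCharge ξ) (ofBase (scalarProduct g η ζ))
      = -(c • ofBase (scalarProduct g η ζ)
        + ofBase (scalarProduct g (VectorField.mlieBracket (𝓡 n) ξ η) ζ)
        + ofBase (scalarProduct g (VectorField.mlieBracket (𝓡 n) ξ ζ) η)) := by
  refine poisson_eq_of_coordPoisson fun φ hφ y hy a => ?_
  have e : inCoords φ (-(c • ofBase (scalarProduct g η ζ)
        + ofBase (scalarProduct g (VectorField.mlieBracket (𝓡 n) ξ η) ζ)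
        + ofBase (scalarProduct g (VectorField.mlieBracket (𝓡 n) ξ ζ) η))) y a
      = -(c * scalarProduct g η ζ (φ.symm y)
        + scalarProduct g (VectorField.mlieBracket (𝓡 n) ξ η) ζ (φ.symm y)
        + scalarProduct g (VectorField.mlieBracket (𝓡 n) ξ ζ) η (φ.symm y)) := rfl
  have k := hξ.isHomotheticOn hφ y hy (chartField φ η y) (chartField φ ζ y)
  have d := (fderiv_scalarProduct_symm hη hζ hφ hy (chartField φ ξ y)).2
  rw [coordPoisson_eq (fun v => (fderiv_linearCharge_momentum ξ y a v).2)
    (fun v => fderiv_ofBase_momentum _ y a v), map_zero, e]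
  simp only [scalarProduct_symm hφ hy]
  rw [chartField_mlieBracket hφ hξ.smooth hη.smooth hy,
    chartField_mlieBracket hφ hξ.smooth hζ.smooth hy, VectorField.lieBracket,
    VectorField.lieBracket]
  change 0 - fderiv ℝ (fun z => scalarProduct g η ζ (φ.symm z)) y (chartField φ ξ y) = _
  rw [d]
  simp only [map_sub, sub_apply]
  simp only [chartForm_symm g φ y (chartField φ η y) (fderiv ℝ _ _ _)] at k ⊢
  linear_combination -k

theorem poisson_scalarProduct_hamiltonian (hξ : IsHomothetic g ξ c) (hη : IsHomothetic g η c') :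
    poisson (ofBase (scalarProduct g ξ η)) (hamiltonian g)
      = fun x p => mfderiv (𝓡 n) 𝓘(ℝ, ℝ) (scalarProduct g ξ η) x (g.sharp x p) := by
  refine poisson_eq_of_coordPoisson fun φ hφ y hy a => ?_
  rw [coordPoisson_eq (fun v => fderiv_ofBase_momentum _ y a v)
    (fun v => (fderiv_hamiltonian_momentum g hφ hy a v).2), map_zero, sub_zero]
  have d := (fderiv_scalarProduct_symm hξ hη hφ hy 0).1
  have e : mfderiv (𝓡 n) (𝓡 n) φ.symm y (chartSharp g φ y a)
      = g.sharp (φ.symm y) (∑ μ, a μ • coordForm φ μ (φ.symm y)) := by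
    rw [← mfderiv_sharp g hφ hy]
    exact mfderiv_symm_mfderiv_chart hφ hy _
  refine (mfderiv_mfderiv_symm hφ hy d _).symm.trans ?_
  rw [e]
  rfl

/-- The homothetic equation gives B(w, ∇_Y X) = c B(w, Y) - B(Y, ∇_w X), and likewise with X and Y
exchanged. The two negative terms add up to minus the derivative of B(X, Y) along w. -/
theorem IsLeviCivita.metric_symProduct_eq {E : Type*} [NormedAddCommGroup E] [NormedSpace ℝ E]
    {U : Set E} {B : E → E →L[ℝ] E →L[ℝ] ℝ} {Γ : E → E →L[ℝ] E →L[ℝ] E} {X Y : E → E}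
    {c c' : ℝ} {y : E} (h : IsLeviCivita U B Γ) (hX : IsHomotheticOn U B X c)
    (hY : IsHomotheticOn U B Y c') (hy : y ∈ U) (w : E) :
    B y w (covDeriv Γ Y y (X y) + covDeriv Γ X y (Y y))
      = c * B y w (Y y) + c' * B y w (X y)
        - (fderiv ℝ B y w (X y) (Y y) + B y (fderiv ℝ X y w) (Y y)
          + B y (X y) (fderiv ℝ Y y w)) := by
  have k := h.koszul y hy (X y) (Y y) w
  have k1 := hX y hy w (Y y)
  have k2 := hY y hy w (X y)
  rw [h.symm y hy] at k
  rw [h.fderiv_symm hy (X y) (Y y)] at k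
  rw [h.fderiv_symm hy (Y y) (X y)] at k
  rw [h.symm y hy _ (X y)] at k2
  simp only [covDeriv, map_add]
  rw [h.conn_symm hy (Y y) (X y)]
  linear_combination 2 * k + k1 + k2

end Brackets

/-! ### Closure of the algebra and the symmetric product condition -/

section Closure

variable {n : ℕ} {M : Type*} [TopologicalSpace M] [ChartedSpace (Coord n) M]

variable (n M) in
/-- Phase space functions which are differentiable in the positions and in the momenta, in every
chart. -/
def differentiableFun : Submodule ℝ (PhaseFun n M) where
  carrier := {F | ∀ φ ∈ charts n M, ∀ y ∈ φ.target, ∀ a,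
    DifferentiableAt ℝ (fun z => inCoords φ F z a) y ∧
    DifferentiableAt ℝ (fun b => inCoords φ F y b) a}
  add_mem' hF hK φ hφ y hy a :=
    ⟨(hF φ hφ y hy a).1.add (hK φ hφ y hy a).1, (hF φ hφ y hy a).2.add (hK φ hφ y hy a).2⟩
  zero_mem' _ _ _ _ _ := ⟨differentiableAt_const (0 : ℝ), differentiableAt_const (0 : ℝ)⟩
  smul_mem' r _ hF φ hφ y hy a :=
    ⟨(hF φ hφ y hy a).1.const_mul r, (hF φ hφ y hy a).2.const_mul r⟩

theorem pd_add {f f' : Coord n → ℝ} {y : Coord n} (hf : DifferentiableAt ℝ f y)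
    (hf' : DifferentiableAt ℝ f' y) (μ : Fin n) :
    pd μ (fun z => f z + f' z) y = pd μ f y + pd μ f' y := by
  rw [pd, fderiv_fun_add hf hf']
  rfl

theorem pd_const_mul {f : Coord n → ℝ} {y : Coord n} (hf : DifferentiableAt ℝ f y) (r : ℝ)
    (μ : Fin n) : pd μ (fun z => r * f z) y = r * pd μ f y := by
  rw [pd, fderiv_const_mul hf]
  rfl

variable [IsManifold (𝓡 n) ∞ M] {g : PseudoMetric n M}

/-- Differentiability is required because `fderiv` takes the value 0 where the derivative does not
exist, which would break additivity. -/
theorem poisson_add_left {F F' : PhaseFun n M} (hF : F ∈ differentiableFun n M)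
    (hF' : F' ∈ differentiableFun n M) (K : PhaseFun n M) :
    poisson (F + F') K = poisson F K + poisson F' K := by
  have key : ∀ φ ∈ charts n M, ∀ y ∈ φ.target, ∀ a,
      coordPoisson φ (F + F') K y a = coordPoisson φ F K y a + coordPoisson φ F' K y a := by
    intro φ hφ y hy a
    rw [coordPoisson, coordPoisson, coordPoisson, ← Finset.sum_add_distrib]
    refine Finset.sum_congr rfl fun μ _ => ?_
    have e1 : pd μ (fun z => inCoords φ (F + F') z a) y = _ :=
      pd_add (hF φ hφ y hy a).1 (hF' φ hφ y hy a).1 μ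
    have e2 : pd μ (fun b => inCoords φ (F + F') y b) a = _ :=
      pd_add (hF φ hφ y hy a).2 (hF' φ hφ y hy a).2 μ
    rw [e1, e2]
    ring
  funext x p
  exact key _ (IsManifold.chart_mem_maximalAtlas x) _ (mem_chart_target _ x) _

theorem poisson_smul_left {F : PhaseFun n M} (hF : F ∈ differentiableFun n M) (r : ℝ)
    (K : PhaseFun n M) : poisson (r • F) K = r • poisson F K := by
  have key : ∀ φ ∈ charts n M, ∀ y ∈ φ.target, ∀ a,
      coordPoisson φ (r • F) K y a = r * coordPoisson φ F K y a := by
    intro φ hφ y hy a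
    rw [coordPoisson, coordPoisson, Finset.mul_sum]
    refine Finset.sum_congr rfl fun μ _ => ?_
    have e1 : pd μ (fun z => inCoords φ (r • F) z a) y = _ :=
      pd_const_mul (hF φ hφ y hy a).1 r μ
    have e2 : pd μ (fun b => inCoords φ (r • F) y b) a = _ :=
      pd_const_mul (hF φ hφ y hy a).2 r μ
    rw [e1, e2]
    ring
  funext x p
  exact key _ (IsManifold.chart_mem_maximalAtlas x) _ (mem_chart_target _ x) _

theorem poisson_zero_left (K : PhaseFun n M) : poisson 0 K = 0 := by
  simpa using poisson_smul_left (zero_mem (differentiableFun n M)) 0 K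

/-- Linearity in the first argument, used twice with antisymmetry in between, reduces closure to
brackets of generators. -/
theorem poisson_mem_span {S : Set (PhaseFun n M)} (hS : S ⊆ differentiableFun n M)
    (h : ∀ F ∈ S, ∀ K ∈ S, poisson F K ∈ Submodule.span ℝ S) {F K : PhaseFun n M}
    (hF : F ∈ Submodule.span ℝ S) (hK : K ∈ Submodule.span ℝ S) :
    poisson F K ∈ Submodule.span ℝ S := by
  have hS' : Submodule.span ℝ S ≤ differentiableFun n M := Submodule.span_le.2 hS
  have left : ∀ K' : PhaseFun n M, (∀ F' ∈ S, poisson F' K' ∈ Submodule.span ℝ S) →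
      ∀ F' ∈ Submodule.span ℝ S, poisson F' K' ∈ Submodule.span ℝ S := by
    intro K' hK' F' hF'
    induction hF' using Submodule.span_induction with
    | mem F' h' => exact hK' F' h'
    | zero => rw [poisson_zero_left]; exact zero_mem _
    | add F₁ F₂ h₁ h₂ i₁ i₂ => rw [poisson_add_left (hS' h₁) (hS' h₂)]; exact add_mem i₁ i₂
    | smul r F₁ h₁ i₁ => rw [poisson_smul_left (hS' h₁)]; exact Submodule.smul_mem _ r i₁
  refine left K (fun F' hF' => ?_) F hF
  rw [poisson_antisymm]
  exact neg_mem (left F' (fun K' hK' => h K' hK' F' hF') K hK)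

variable {ι : Type*} {ξ : ι → ∀ x : M, TangentSpace (𝓡 n) x} {lam : ι → ℝ}

theorem hamiltonian_mem_chargeSpan : hamiltonian g ∈ chargeSpan g ξ :=
  Submodule.subset_span (Or.inl (Or.inl rfl))

theorem linearCharge_mem_chargeSpan (i : ι) : linearCharge (ξ i) ∈ chargeSpan g ξ :=
  Submodule.subset_span (Or.inl (Or.inr ⟨i, rfl⟩))

theorem scalarProduct_mem_chargeSpan (i j : ι) :
    ofBase (scalarProduct g (ξ i) (ξ j)) ∈ chargeSpan g ξ :=
  Submodule.subset_span (Or.inr ⟨(i, j), rfl⟩)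

theorem linearCharge_mem_chargeSpan_of_mem_span {η : ∀ x : M, TangentSpace (𝓡 n) x}
    (hη : η ∈ Submodule.span ℝ (Set.range ξ)) : linearCharge η ∈ chargeSpan g ξ := by
  induction hη using Submodule.span_induction with
  | mem η h =>
    obtain ⟨i, rfl⟩ := h
    exact linearCharge_mem_chargeSpan i
  | zero =>
    rw [show linearCharge (0 : ∀ x : M, TangentSpace (𝓡 n) x) = 0 from
      funext fun x => funext fun p => map_zero p]
    exact zero_mem _
  | add η η' _ _ h h' =>
    rw [show linearCharge (η + η') = linearCharge η + linearCharge η' from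
      funext fun x => funext fun p => map_add p _ _]
    exact add_mem h h'
  | smul r η _ h =>
    rw [show linearCharge (r • η) = r • linearCharge η from
      funext fun x => funext fun p => map_smul p _ _]
    exact Submodule.smul_mem _ r h

theorem scalarProduct_mem_chargeSpan_of_mem_span {η : ∀ x : M, TangentSpace (𝓡 n) x}
    (hη : η ∈ Submodule.span ℝ (Set.range ξ)) (j : ι) :
    ofBase (scalarProduct g η (ξ j)) ∈ chargeSpan g ξ := by
  induction hη using Submodule.span_induction with
  | mem η h =>
    obtain ⟨i, rfl⟩ := h
    exact scalarProduct_mem_chargeSpan i j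
  | zero =>
    rw [show ofBase (scalarProduct g (0 : ∀ x : M, TangentSpace (𝓡 n) x) (ξ j)) = 0 from
      funext fun x => funext fun p => by
        change g.form x 0 (ξ j x) = 0
        rw [map_zero]
        rfl]
    exact zero_mem _
  | add η η' _ _ h h' =>
    rw [show ofBase (scalarProduct g (η + η') (ξ j))
        = ofBase (scalarProduct g η (ξ j)) + ofBase (scalarProduct g η' (ξ j)) from
      funext fun x => funext fun p => by
        change g.form x (η x + η' x) (ξ j x) = _
        rw [map_add]
        rfl]
    exact add_mem h h'
  | smul r η _ h =>
    rw [show ofBase (scalarProduct g (r • η) (ξ j)) = r • ofBase (scalarProduct g η (ξ j)) from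
      funext fun x => funext fun p => by
        change g.form x (r • η x) (ξ j x) = _
        rw [map_smul]
        rfl]
    exact Submodule.smul_mem _ r h

theorem hamiltonian_neg (x : M) (p : TangentSpace (𝓡 n) x →L[ℝ] ℝ) :
    hamiltonian g x (-p) = hamiltonian g x p := by
  rw [hamiltonian, hamiltonian, sharp_neg, map_neg]
  exact congrArg (1 / 2 * ·) (neg_neg _)

theorem hamiltonian_mem_differentiableFun : hamiltonian g ∈ differentiableFun n M :=
  fun _ hφ _ hy a => ⟨(fderiv_hamiltonian_position g hφ hy a 0).1,
    (fderiv_hamiltonian_momentum g hφ hy a 0).1⟩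

theorem linearCharge_mem_differentiableFun {η : ∀ x : M, TangentSpace (𝓡 n) x} {c : ℝ}
    (hη : IsHomothetic g η c) : linearCharge η ∈ differentiableFun n M :=
  fun _ hφ _ hy a => ⟨(fderiv_linearCharge_position (hη.differentiableAt_chartField hφ hy) a 0).1,
    (fderiv_linearCharge_momentum η _ a 0).1⟩

theorem scalarProduct_mem_differentiableFun {η ζ : ∀ x : M, TangentSpace (𝓡 n) x} {c c' : ℝ}
    (hη : IsHomothetic g η c) (hζ : IsHomothetic g ζ c') :
    ofBase (scalarProduct g η ζ) ∈ differentiableFun n M :=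
  fun _ hφ _ hy _ => ⟨(fderiv_scalarProduct_symm hη hζ hφ hy 0).1, differentiableAt_const _⟩

/-- The Lie bracket hypothesis handles {C, C} and {C, V}. The gradient hypothesis turns {V, H} into
a combination of the C. -/
theorem closesAlgebra_of_gradient [Fintype ι] (hξ : ∀ i, IsHomothetic g (ξ i) (lam i))
    (hL : ∀ i j, VectorField.mlieBracket (𝓡 n) (ξ i) (ξ j) ∈ Submodule.span ℝ (Set.range ξ))
    (hG : ∀ i j, ∃ β : ι → ℝ, ∀ (x : M) (w : TangentSpace (𝓡 n) x),
      mfderiv (𝓡 n) 𝓘(ℝ, ℝ) (scalarProduct g (ξ i) (ξ j)) x w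
        = ∑ k, β k * g.form x w (ξ k x)) : ClosesAlgebra g ξ := by
  have hCV : ∀ i j k, poisson (linearCharge (ξ i)) (ofBase (scalarProduct g (ξ j) (ξ k)))
      ∈ chargeSpan g ξ := by
    intro i j k
    rw [poisson_linearCharge_scalarProduct (hξ i) (hξ j) (hξ k)]
    exact neg_mem (add_mem (add_mem
      (Submodule.smul_mem _ _ (scalarProduct_mem_chargeSpan j k))
      (scalarProduct_mem_chargeSpan_of_mem_span (hL i j) k))
      (scalarProduct_mem_chargeSpan_of_mem_span (hL i k) j))
  have hVH : ∀ i j, poisson (ofBase (scalarProduct g (ξ i) (ξ j))) (hamiltonian g)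
      ∈ chargeSpan g ξ := by
    intro i j
    obtain ⟨β, hβ⟩ := hG i j
    have e : poisson (ofBase (scalarProduct g (ξ i) (ξ j))) (hamiltonian g)
        = ∑ k, β k • linearCharge (ξ k) := by
      rw [poisson_scalarProduct_hamiltonian (hξ i) (hξ j)]
      funext x p
      rw [Finset.sum_apply, Finset.sum_apply]
      refine (hβ x _).trans (Finset.sum_congr rfl fun k _ => ?_)
      rw [form_sharp]
      rfl
    rw [e]
    exact sum_mem fun k _ => Submodule.smul_mem _ _ (linearCharge_mem_chargeSpan k)
  have hCH : ∀ i, poisson (linearCharge (ξ i)) (hamiltonian g) ∈ chargeSpan g ξ := by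
    intro i
    rw [poisson_linearCharge_hamiltonian (hξ i)]
    exact Submodule.smul_mem _ _ hamiltonian_mem_chargeSpan
  have hanti : ∀ F K : PhaseFun n M, poisson F K ∈ chargeSpan g ξ →
      poisson K F ∈ chargeSpan g ξ := by
    intro F K h
    rw [poisson_antisymm]
    exact neg_mem h
  refine fun F hF K hK => poisson_mem_span ?_ ?_ hF hK
  · rintro _ ((rfl | ⟨i, rfl⟩) | ⟨⟨i, j⟩, rfl⟩)
    · exact hamiltonian_mem_differentiableFun
    · exact linearCharge_mem_differentiableFun (hξ i)
    · exact scalarProduct_mem_differentiableFun (hξ i) (hξ j)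
  · rintro _ ((rfl | ⟨i, rfl⟩) | ⟨⟨i, j⟩, rfl⟩) _ ((rfl | ⟨i', rfl⟩) | ⟨⟨i', j'⟩, rfl⟩)
    · rw [poisson_self]
      exact zero_mem _
    · exact hanti _ _ (hCH i')
    · exact hanti _ _ (hVH i' j')
    · exact hCH i
    · rw [poisson_linearCharge_linearCharge (hξ i) (hξ i')]
      exact neg_mem (linearCharge_mem_chargeSpan_of_mem_span (hL i i'))
    · exact hCV i i' j'
    · exact hVH i j
    · exact hanti _ _ (hCV i' i j)
    · rw [poisson_ofBase_ofBase]
      exact zero_mem _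

variable [Fintype ι]

/-- The part of a charge which is odd in the momenta is a combination of the linear charges. -/
theorem exists_odd_part_of_mem_chargeSpan {F : PhaseFun n M} (hF : F ∈ chargeSpan g ξ) :
    ∃ β : ι → ℝ, ∀ (x : M) (p : TangentSpace (𝓡 n) x →L[ℝ] ℝ),
      F x p - F x (-p) = 2 * ∑ k, β k * p (ξ k x) := by
  classical
  induction hF using Submodule.span_induction with
  | mem F h =>
    obtain ((rfl | ⟨i, rfl⟩) | ⟨⟨i, j⟩, rfl⟩) := h
    · exact ⟨0, fun x p => by rw [hamiltonian_neg]; simp⟩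
    · refine ⟨Pi.single i 1, fun x p => ?_⟩
      have e : ∑ k, (Pi.single i 1 : ι → ℝ) k * p (ξ k x) = p (ξ i x) := by
        simp [Pi.single_apply]
      rw [e]
      change p (ξ i x) - -p (ξ i x) = _
      ring
    · exact ⟨0, fun x p => by simp [ofBase]⟩
  | zero => exact ⟨0, fun x p => by simp⟩
  | add F K _ _ h h' =>
    obtain ⟨β, hβ⟩ := h
    obtain ⟨β', hβ'⟩ := h'
    refine ⟨β + β', fun x p => ?_⟩
    simp only [Pi.add_apply, add_mul, Finset.sum_add_distrib, mul_add, ← hβ, ← hβ']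
    ring
  | smul r F _ h =>
    obtain ⟨β, hβ⟩ := h
    refine ⟨r • β, fun x p => ?_⟩
    simp only [Pi.smul_apply, smul_eq_mul, mul_assoc, ← Finset.mul_sum]
    linear_combination r * hβ x p

/-- The bracket {V, H} is odd in p, whereas H and the V are even. Passing to odd parts discards the
latter without any linear independence of the generators, and the momentum p = g(w, ·) then recovers
dV(w). -/
theorem gradient_of_closesAlgebra (hξ : ∀ i, IsHomothetic g (ξ i) (lam i))
    (h : ClosesAlgebra g ξ) (i j : ι) :
    ∃ β : ι → ℝ, ∀ (x : M) (w : TangentSpace (𝓡 n) x),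
      mfderiv (𝓡 n) 𝓘(ℝ, ℝ) (scalarProduct g (ξ i) (ξ j)) x w
        = ∑ k, β k * g.form x w (ξ k x) := by
  have hmem := h _ (scalarProduct_mem_chargeSpan i j) _ hamiltonian_mem_chargeSpan
  rw [poisson_scalarProduct_hamiltonian (hξ i) (hξ j)] at hmem
  obtain ⟨β, hβ⟩ := exists_odd_part_of_mem_chargeSpan hmem
  refine ⟨β, fun x w => ?_⟩
  have hw : g.sharp x (g.form x w) = w := form_injective g x (form_sharp g x _)
  let L : Coord n →L[ℝ] ℝ := mfderiv (𝓡 n) 𝓘(ℝ, ℝ) (scalarProduct g (ξ i) (ξ j)) x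
  have k : L (g.sharp x (g.form x w)) - L (g.sharp x (-g.form x w))
      = 2 * ∑ k, β k * g.form x w (ξ k x) := hβ x (g.form x w)
  have e : L (g.sharp x (-g.form x w)) = -L w := by
    rw [sharp_neg, hw]
    exact L.map_neg w
  rw [hw, e] at k
  change L w = _
  linarith

/-- The symmetric product and dV add up to λ_i ξ_j + λ_j ξ_i with lowered index, itself a
combination of the family. So one is such a combination exactly when the other is. -/
theorem symProductCondition_iff_gradient (hξ : ∀ i, IsHomothetic g (ξ i) (lam i)) :
    SymProductCondition g ξ ↔ ∀ i j, ∃ β : ι → ℝ, ∀ (x : M) (w : TangentSpace (𝓡 n) x),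
      mfderiv (𝓡 n) 𝓘(ℝ, ℝ) (scalarProduct g (ξ i) (ξ j)) x w
        = ∑ k, β k * g.form x w (ξ k x) := by
  classical
  refine forall₂_congr fun i j => ?_
  have key : ∀ φ ∈ charts n M, ∀ y ∈ φ.target, ∀ μ,
      symProduct (metricComp g φ) (vecComp φ (ξ i)) (vecComp φ (ξ j)) μ y
        = lam i * lower (metricComp g φ) (vecComp φ (ξ j)) μ y
          + lam j * lower (metricComp g φ) (vecComp φ (ξ i)) μ y
          - fderiv ℝ (fun z => scalarProduct g (ξ i) (ξ j) (φ.symm z)) y (basisVec μ) := by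
    intro φ hφ y hy μ
    have hC := isLeviCivita_chart g hφ
    rw [metricComp_eq, vecComp_eq, vecComp_eq, hC.symProduct_eq hy
      ((hξ i).differentiableAt_chartField hφ hy) ((hξ j).differentiableAt_chartField hφ hy),
      lower_eq, lower_eq, (fderiv_scalarProduct_symm (hξ i) (hξ j) hφ hy _).2,
      hC.metric_symProduct_eq ((hξ i).isHomotheticOn hφ) ((hξ j).isHomotheticOn hφ) hy]
  have hlow : ∀ φ ∈ charts n M, ∀ y ∈ φ.target, ∀ μ k,
      lower (metricComp g φ) (vecComp φ (ξ k)) μ y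
        = chartForm g φ y (basisVec μ) (chartField φ (ξ k) y) := fun φ _ y _ μ k => by
    rw [metricComp_eq, vecComp_eq, lower_eq]
  have hshift : ∀ (α v : ι → ℝ), ∑ k, (Pi.single j (lam i) + Pi.single i (lam j) - α : ι → ℝ) k * v k
      = lam i * v j + lam j * v i - ∑ k, α k * v k := by
    intro α v
    simp [add_mul, sub_mul, Finset.sum_add_distrib, Pi.single_apply]
  have hform : ∀ φ ∈ charts n M, ∀ y ∈ φ.target, ∀ (w : Coord n) k,
      g.form (φ.symm y) (mfderiv (𝓡 n) (𝓡 n) φ.symm y w) (ξ k (φ.symm y))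
        = chartForm g φ y w (chartField φ (ξ k) y) := fun φ hφ y hy w k =>
    congrArg (g.form (φ.symm y) (mfderiv (𝓡 n) (𝓡 n) φ.symm y w))
      (mfderiv_symm_chartField hφ hy (ξ k)).symm
  constructor
  · rintro ⟨α, hα⟩
    -- The coefficients are those of λ_i ξ_j + λ_j ξ_i minus α. The same substitution, an
    -- involution, serves for the converse.
    refine ⟨Pi.single j (lam i) + Pi.single i (lam j) - α, fun x w => ?_⟩
    have hφ : chartAt (Coord n) x ∈ charts n M := IsManifold.chart_mem_maximalAtlas x
    have hx := mem_chart_source (Coord n) x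
    generalize chartAt (Coord n) x = φ at hφ hx
    -- The claim is proved at φ⁻¹(y) for all y, so that φ⁻¹(φ x) can be rewritten to x together with
    -- the type of w.
    have H : ∀ y ∈ φ.target, ∀ w : TangentSpace (𝓡 n) (φ.symm y),
        mfderiv (𝓡 n) 𝓘(ℝ, ℝ) (scalarProduct g (ξ i) (ξ j)) (φ.symm y) w
          = ∑ k, (Pi.single j (lam i) + Pi.single i (lam j) - α : ι → ℝ) k
            * g.form (φ.symm y) w (ξ k (φ.symm y)) := by
      intro y hy w
      rw [← mfderiv_symm_mfderiv_chart hφ hy w]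
      refine (mfderiv_mfderiv_symm hφ hy
        (fderiv_scalarProduct_symm (hξ i) (hξ j) hφ hy 0).1 _).trans ?_
      refine Eq.trans ?_ (Finset.sum_congr rfl fun k _ =>
        congrArg (_ * ·) (hform φ hφ y hy _ k).symm)
      refine isLinearMap_ext_basis
        (f := fun v => fderiv ℝ (fun z => scalarProduct g (ξ i) (ξ j) (φ.symm z)) y v)
        (f' := fun v => ∑ k, (Pi.single j (lam i) + Pi.single i (lam j) - α : ι → ℝ) k
          * chartForm g φ y v (chartField φ (ξ k) y))
        ⟨fun a b => map_add _ a b, fun r a => map_smul _ r a⟩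
        ⟨fun a b => ?_, fun r a => ?_⟩ (fun μ => ?_) _
      · simp only [map_add, add_apply, mul_add, Finset.sum_add_distrib]
      · simp only [map_smul, FunLike.coe_smul, Pi.smul_apply, smul_eq_mul, Finset.mul_sum]
        exact Finset.sum_congr rfl fun k _ => by ring
      · have k := hα φ hφ y hy μ
        rw [key φ hφ y hy] at k
        simp only [hlow φ hφ y hy] at k
        simp only [hshift]
        linarith
    have h := H (φ x) (φ.map_source hx)
    rw [φ.left_inv hx] at h
    exact h w
  · rintro ⟨β, hβ⟩
    refine ⟨Pi.single j (lam i) + Pi.single i (lam j) - β, fun φ hφ y hy μ => ?_⟩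
    rw [key φ hφ y hy, hshift, ← mfderiv_mfderiv_symm hφ hy
      (fderiv_scalarProduct_symm (hξ i) (hξ j) hφ hy 0).1, hβ]
    simp only [hlow φ hφ y hy, hform φ hφ y hy]

end Closure

end FieldSpace

end

theorem mainTheorem5 {n : ℕ} {M : Type*} [TopologicalSpace M]
    [ChartedSpace (FieldSpace.Coord n) M] [IsManifold (𝓡 n) ∞ M]
    (g : FieldSpace.PseudoMetric n M) {ι : Type*} [Fintype ι]
    (ξ : ι → ∀ x : M, TangentSpace (𝓡 n) x) (lam : ι → ℝ)
    (hξ : ∀ i, FieldSpace.IsHomothetic g (ξ i) (lam i)) :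
    -- the third derivative along geodesics, in every chart
    (∀ (γ : ℝ → M) (J : Set ℝ), IsOpen J → FieldSpace.IsGeodesicOn g γ J →
      ∀ i j, ∀ t ∈ J,
        ContDiffAt ℝ 3 (fun s => FieldSpace.scalarProduct g (ξ i) (ξ j) (γ s)) t ∧
        ∀ φ ∈ FieldSpace.charts n M, γ t ∈ φ.source →
          iteratedDeriv 3 (fun s => FieldSpace.scalarProduct g (ξ i) (ξ j) (γ s)) t
            = FieldSpace.thirdDerivExpr (FieldSpace.metricComp g φ)
                (FieldSpace.vecComp φ (ξ i)) (FieldSpace.vecComp φ (ξ j))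
                (FieldSpace.velocity φ γ t) (φ (γ t))) ∧
    -- it vanishes in flat field space
    (FieldSpace.IsFlat g →
      ∀ (γ : ℝ → M) (J : Set ℝ), IsOpen J → FieldSpace.IsGeodesicOn g γ J →
        ∀ i j, ∀ t ∈ J,
          iteratedDeriv 3 (fun s => FieldSpace.scalarProduct g (ξ i) (ξ j) (γ s)) t = 0) ∧
    -- closure criterion, when the family spans the whole set of homothetic fields
    ((∀ (η : ∀ x : M, TangentSpace (𝓡 n) x) (c : ℝ), FieldSpace.IsHomothetic g η c →
        η ∈ Submodule.span ℝ (Set.range ξ)) →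
      (FieldSpace.ClosesAlgebra g ξ ↔ FieldSpace.SymProductCondition g ξ)) ∧
    -- and, more generally, when the family spans a Lie algebra of homothetic fields
    ((∀ i j, VectorField.mlieBracket (𝓡 n) (ξ i) (ξ j) ∈ Submodule.span ℝ (Set.range ξ)) →
      (FieldSpace.ClosesAlgebra g ξ ↔ FieldSpace.SymProductCondition g ξ)) := by
  have hgrad := FieldSpace.symProductCondition_iff_gradient hξ
  have hclosed : (∀ i j, VectorField.mlieBracket (𝓡 n) (ξ i) (ξ j)
      ∈ Submodule.span ℝ (Set.range ξ)) →
      (FieldSpace.ClosesAlgebra g ξ ↔ FieldSpace.SymProductCondition g ξ) := fun hL =>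
    ⟨fun h => hgrad.2 (FieldSpace.gradient_of_closesAlgebra hξ h),
      fun h => FieldSpace.closesAlgebra_of_gradient hξ hL (hgrad.1 h)⟩
  -- The spanning case reduces to the Lie-closed one: brackets of homothetic fields are homothetic
  -- with constant 0, hence in the span.
  refine ⟨fun γ J hJ hγ i j t ht => ⟨?_, fun φ hφ hs => ?_⟩, fun hflat γ J hJ hγ i j t ht => ?_,
    fun hspan => hclosed fun i j => hspan _ 0 ((hξ i).mlieBracket (hξ j)), hclosed⟩
  · exact (hγ.contDiffAt_scalarProduct hJ (hξ i) (hξ j) ht).of_le ENat.LEInfty.out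
  · exact hγ.iteratedDeriv_scalarProduct hJ (hξ i) (hξ j) ht hφ hs
  · have hφ : chartAt (FieldSpace.Coord n) (γ t) ∈ FieldSpace.charts n M :=
      IsManifold.chart_mem_maximalAtlas _
    rw [hγ.iteratedDeriv_scalarProduct hJ (hξ i) (hξ j) ht hφ (mem_chart_source _ _)]
    exact FieldSpace.thirdDerivExpr_eq_zero (chartAt (FieldSpace.Coord n) (γ t)).open_target
      (hflat _ hφ) (mem_chart_target _ _) _ _ _
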